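/- **Setting.** Let $g:\mathbb{R}\to[0,\infty)$ be a probability density, and let $(u,v)=\int_{\mathbb{R}}u(\omega)\overline{v(\omega)}g(\omega)\,d\omega$ be the inner product of the complex Hilbert space $L^2(\mathbb{R},g(\omega)d\omega)$. Put $P_0\equiv 1$, $(\mathcal{M}u)(\omega)=\omega u(\omega)$ with its maximal domain, $\mathcal{P}u=(u,P_0)P_0$, and for $K>0$, $f_1\in\mathbb{C}$ let $$T_1=i\mathcal{M}+iKf_1\mathcal{P},\qquad \mathsf{D}(T_1)=\mathsf{D}(\mathcal{M}).$$ Let $q\in L^2(\mathbb{R},g(\omega)d\omega)$, and put $D(\lambda)=\int_{\mathbb{R}}\frac{g(\omega)}{\lambda-i\omega}d\omega$ and $F_0(\lambda)=((\lambda-T_1)^{-1}q,P_0)$ for $\operatorname{Re}\lambda>0$. **Theorem 3.12.** Let $\operatorname{Im}(f_1)\ge 0$ and let $K>0$ be fixed. Suppose that (ii) $g$ is real analytic on $\mathbb{R}$ and has a meromorphic continuation $g^*$ to the upper half plane; (iii) $q$ is (complex-valued) real analytic on $\mathbb{R}$ and has an analytic continuation $q^*$ to the upper half plane. Let $F_1$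 be the meromorphic function on $\mathbb{C}$ that equals $F_0$ on $\operatorname{Re}\lambda>0$ and is given on $\operatorname{Re}\lambda<0$ by $$F_1(\lambda)=\frac{\int_{\mathbb{R}}\frac{q(\omega)g(\omega)}{\lambda-i\omega}d\omega+2\pi q^*(-i\lambda)g^*(-i\lambda)}{1-iKf_1D(\lambda)-2\pi iKf_1g^*(-i\lambda)}.$$ Suppose that there is $\delta>0$ such that (iv) $F_1(\lambda)\to0$ as $|\lambda|\to\infty$ in the sectors $|\arg\lambda-\pi/2|\le\delta$ and $|\arg\lambda+\pi/2|\le\delta$; (v) there are constants $C,\beta>0$ and radii $r_n\to\infty$ such that $|F_1(\lambda)|\le Ce^{\beta|\lambda|}$ for all $\lambda$ with $|\lambda|=r_n$ and $\pi/2+\delta\le\arg\lambda\le3\pi/2-\delta$. If $f_1$ is real, suppose moreover that $Kf_1\int_{\mathbb{R}}\frac{g(\omega)}{y-\omega}d\omega\neq1$ for every real zero $y$ of $g$, that is, that $T_1$ has no eigenvalue on the imaginary axis (this holds for all $K>0$ if $g$ has no real zero). Then $T_1$ generates a strongly continuous semigroup $e^{T_1t}$, and the linearized order parameter decays exponentially: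 there are constants $C'$ and $\gamma>0$ such that $|(e^{T_1t}q,P_0)|\le C'e^{-\gamma t}$ for all $t\ge0$. -/

import Mathlib

open MeasureTheory Filter Topology Complex

noncomputable section

namespace KuramotoDaido

/-- A probability density function on the real line (of the natural frequencies). -/
structure ProbDensity where
  /-- the density -/
  toFun : ℝ → ℝ
  nonneg : ∀ ω, 0 ≤ toFun ω
  integrable : Integrable toFun
  integral_eq_one : ∫ ω, toFun ω = 1

instance : CoeFun ProbDensity (fun _ => ℝ → ℝ) := ⟨ProbDensity.toFun⟩

/-- The measure `g(ω) dω`. -/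
def ProbDensity.measure (g : ProbDensity) : Measure ℝ :=
  volume.withDensity (fun ω => ENNReal.ofReal (g ω))

instance (g : ProbDensity) : IsProbabilityMeasure g.measure := by
  constructor
  rw [ProbDensity.measure, withDensity_apply _ MeasurableSet.univ, Measure.restrict_univ,
    ← ofReal_integral_eq_lintegral_ofReal g.integrable (Eventually.of_forall g.nonneg),
    g.integral_eq_one, ENNReal.ofReal_one]

/-- The complex Hilbert space `L²(ℝ, g(ω)dω)`. -/
abbrev ProbDensity.L2 (g : ProbDensity) : Type := Lp ℂ 2 g.measure

/-- The multiplication operator `(M u)(ω) = ω u(ω)` on `L²(ℝ, g(ω)dω)`, with its maximal domain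
`{u | ω u(ω) ∈ L²}`. -/
def mulOp (g : ProbDensity) : g.L2 →ₗ.[ℂ] g.L2 where
  domain :=
    { carrier := {u | MemLp (fun ω : ℝ => (ω : ℂ) * u ω) 2 g.measure}
      zero_mem' := by
        refine (memLp_congr_ae ?_).2 (MemLp.zero' (ε := ℂ))
        filter_upwards [Lp.coeFn_zero ℂ 2 g.measure] with ω h
        exact (congrArg (fun z => (ω : ℂ) * z) h).trans (mul_zero _)
      add_mem' := by
        intro u v hu hv
        refine (memLp_congr_ae ?_).2 (MemLp.add hu hv)
        filter_upwards [Lp.coeFn_add u v] with ω h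
        exact (congrArg (fun z => (ω : ℂ) * z) h).trans (mul_add _ _ _)
      smul_mem' := by
        intro c u hu
        refine (memLp_congr_ae ?_).2 (MemLp.const_smul hu c)
        filter_upwards [Lp.coeFn_smul c u] with ω h
        simp [h, mul_left_comm] }
  toFun :=
    { toFun := fun u => MemLp.toLp (fun ω : ℝ => (ω : ℂ) * (u : g.L2) ω) u.2
      map_add' := by
        intro u v
        rw [← MemLp.toLp_add]
        refine MemLp.toLp_congr _ _ ?_
        filter_upwards [Lp.coeFn_add (u : g.L2) (v : g.L2)] with ω h
        exact (congrArg (fun z => (ω : ℂ) * z) h).trans (mul_add _ _ _)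
      map_smul' := by
        intro c u
        rw [RingHom.id_apply, ← MemLp.toLp_const_smul]
        refine MemLp.toLp_congr _ _ ?_
        filter_upwards [Lp.coeFn_smul c (u : g.L2)] with ω h
        simp [h, mul_left_comm] }

/-- The constant function `P₀ = 1` as an element of `L²(ℝ, g(ω)dω)`. -/
def P0 (g : ProbDensity) : g.L2 := Lp.const 2 g.measure (1 : ℂ)

/-- The rank-one projection `P u = (u, P₀) P₀`. The inner product `(u, v) = ∫ u v̄ g dω`
(linear in the first argument) is `inner ℂ v u` in Mathlib's convention. -/
def projOp (g : ProbDensity) : g.L2 →ₗ[ℂ] g.L2 where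
  toFun u := inner ℂ (P0 g) u • P0 g
  map_add' u v := by rw [inner_add_right, add_smul]
  map_smul' c u := by rw [inner_smul_right, RingHom.id_apply, mul_smul]

/-- The operator `T₁ = i M + i K f₁ P` with domain that of `M`. -/
def T1 (g : ProbDensity) (K : ℝ) (f₁ : ℂ) : g.L2 →ₗ.[ℂ] g.L2 :=
  (I * K * f₁) • projOp g +ᵥ I • mulOp g

/-- A strongly continuous one-parameter semigroup `(S t)_{t ≥ 0}` of bounded operators
(values at negative times carry no meaning). -/
structure C0Semigroup (H : Type*) [NormedAddCommGroup H] [NormedSpace ℂ H] where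
  /-- the operator at time `t` -/
  toFun : ℝ → H →L[ℂ] H
  map_zero : toFun 0 = ContinuousLinearMap.id ℂ H
  map_add : ∀ s t, 0 ≤ s → 0 ≤ t → toFun (s + t) = (toFun s).comp (toFun t)
  continuousOn : ∀ x, ContinuousOn (fun t => toFun t x) (Set.Ici 0)

/-- `T` is the infinitesimal generator of `S`, that is, `S t = e^{T t}`: a pair `(x, y)` lies in the
graph of `T` if and only if `(S h x - x) / h → y` as `h → 0+`. -/
def C0Semigroup.IsGeneratedBy {H : Type*} [NormedAddCommGroup H] [NormedSpace ℂ H]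
    (S : C0Semigroup H) (T : H →ₗ.[ℂ] H) : Prop :=
  ∀ x y : H, (x, y) ∈ T.graph ↔
    Tendsto (fun h : ℝ => ((h⁻¹ : ℝ) : ℂ) • (S.toFun h x - x)) (𝓝[>] 0) (𝓝 y)

open Classical in
/-- `(z - T)⁻¹ q`: the solution `x` of `z x - T x = q` (and `0` if there is none). -/
def resolventApply {H : Type*} [NormedAddCommGroup H] [NormedSpace ℂ H]
    (T : H →ₗ.[ℂ] H) (z : ℂ) (q : H) : H :=
  if h : ∃ x : T.domain, z • (x : H) - T x = q then (h.choose : H) else 0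

/-- `((z - iM)⁻¹ q, P₀) = ∫ q(ω) g(ω) / (z - iω) dω`. -/
def freePairing (g : ProbDensity) (q : ℝ → ℂ) (z : ℂ) : ℂ :=
  ∫ ω : ℝ, q ω * g ω / (z - I * ω)

/-- `D(z) = ∫ g(ω) / (z - iω) dω`. -/
def stieltjesD (g : ProbDensity) (z : ℂ) : ℂ := ∫ ω : ℝ, (g ω : ℂ) / (z - I * ω)

/-- `F₀(z) = ((z - T₁)⁻¹ q, P₀)`, used for `Re z > 0`. -/
def F0 (g : ProbDensity) (K : ℝ) (f₁ : ℂ) (q : g.L2) (z : ℂ) : ℂ :=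
  inner ℂ (P0 g) (resolventApply (T1 g K f₁) z q)

/-- The continuation of `F₀` from the right to the left half plane, before the values at removable
singularities and at poles are normalised; `gs`, `qs` are the continuations of `g`, `q` to the upper
half plane. On the imaginary axis it is the boundary value from the right. -/
def F1pre (g : ProbDensity) (K : ℝ) (f₁ : ℂ) (q : ℝ → ℂ) (hq : MemLp q 2 g.measure)
    (gs qs : ℂ → ℂ) (z : ℂ) : ℂ :=
  if 0 < z.re then F0 g K f₁ (hq.toLp q) z
  else if z.re < 0 then
    (freePairing g q z + 2 * Real.pi * qs (-I * z) * gs (-I * z)) /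
      (1 - I * K * f₁ * stieltjesD g z - 2 * Real.pi * I * K * f₁ * gs (-I * z))
  else limUnder (𝓝[{w : ℂ | 0 < w.re}] z) (F0 g K f₁ (hq.toLp q))

/-- The meromorphic function `F₁` on `ℂ` that continues `F₀` (in normal form: removable
singularities are filled in, and the value at a pole is set to `0`). -/
def F1 (g : ProbDensity) (K : ℝ) (f₁ : ℂ) (q : ℝ → ℂ) (hq : MemLp q 2 g.measure)
    (gs qs : ℂ → ℂ) : ℂ → ℂ :=
  toMeromorphicNFOn (F1pre g K f₁ q hq gs qs) Set.univ

/-- `φs` continues the real analytic function `φ` meromorphically to the upper half plane. -/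
structure IsMeromorphicContinuation (φ : ℝ → ℂ) (φs : ℂ → ℂ) : Prop where
  eq_real : ∀ x : ℝ, φs x = φ x
  analyticAt_real : ∀ x : ℝ, AnalyticAt ℂ φs x
  meromorphicOn : MeromorphicOn φs {z | 0 < z.im}

/-- `φs` continues the real analytic function `φ` analytically to the upper half plane. -/
structure IsAnalyticContinuation (φ : ℝ → ℂ) (φs : ℂ → ℂ) : Prop where
  eq_real : ∀ x : ℝ, φs x = φ x
  analyticAt_real : ∀ x : ℝ, AnalyticAt ℂ φs x
  analyticOnNhd : AnalyticOnNhd ℂ φs {z | 0 < z.im}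

/-- The two closed sectors of half-opening `δ` around the positive and the negative imaginary
half-axis, `|arg z - π/2| ≤ δ` and `|arg z + π/2| ≤ δ`. -/
def verticalSectors (δ : ℝ) : Set ℂ := {z | |arg (-I * z)| ≤ δ ∨ |arg (I * z)| ≤ δ}

/-- The remaining sector `π/2 + δ ≤ arg z ≤ 3π/2 - δ` of the left half plane. -/
def leftSector (δ : ℝ) : Set ℂ := {z | |arg (-z)| ≤ Real.pi / 2 - δ}

/-- The growth conditions on `F`: for some `δ > 0`, `F(z) → 0` as `|z| → ∞` in the vertical sectors,
and `|F(z)| ≤ C e^{β|z|}` in the left sector. Since `F` may have poles there, the bound is asked for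
on arcs `|z| = r n` with `r n → ∞` only; a bound on the whole sector implies it. -/
def GrowthCondition (F : ℂ → ℂ) : Prop :=
  ∃ δ : ℝ, 0 < δ ∧
    Tendsto F (Bornology.cobounded ℂ ⊓ 𝓟 (verticalSectors δ)) (𝓝 0) ∧
    ∃ C β : ℝ, 0 < C ∧ 0 < β ∧ ∃ r : ℕ → ℝ, Tendsto r atTop atTop ∧
      ∀ n, ∀ z ∈ leftSector δ, ‖z‖ = r n → ‖F z‖ ≤ C * Real.exp (β * ‖z‖)

/-- Exponential decay of `Z(t)` as `t → ∞`. -/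
def DecaysExponentially (Z : ℝ → ℂ) : Prop :=
  ∃ C γ : ℝ, 0 < γ ∧ ∀ t, 0 ≤ t → ‖Z t‖ ≤ C * Real.exp (-γ * t)

end KuramotoDaido

end

/-! Write `Z t` for the order parameter `(e^{T₁t} q, P₀)`. The operator `iM` generates a unitary
group and `P` has rank one, so `T₁` generates a semigroup (`exists_semigroup`). Since `Im f₁ ≥ 0`,
`T₁` is dissipative. The semigroup is therefore contractive, `Z` is bounded, and its Laplace
transform on `Re z > 0` is `F₀ = Q / (1 - iKf₁D)`, where `Q` and `D` are the Cauchy integrals of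
`qg` and `g` (`F0_eq`, `laplace_eq_F0`).

Because the densities are real analytic, these Cauchy integrals continue across the imaginary axis,
with jump `2π` times the density (`exists_analytic_continuation_cauchy`). On the axis the continued
`D` has real part `πg ≥ 0`. A zero of the denominator there would force `-K Im f₁ |D|² = πg`, hence
both sides zero, and that case is excluded by the eigenvalue hypothesis
(`boundary_denominator_ne_zero`). So `F₁` is analytic on the closed right half plane.

Decay of `F₁` in the vertical sectors rules out poles far out near the axis, and compactness handles
the bounded part, so `F₁` is analytic on some `Re z ≥ -γ`. Cauchy estimates on discs of radius
proportional to `|Im z|` give `F₁'' = O(1 / (Im z)²)` (`exists_strip_bound`). As `F₁''` is the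
Laplace transform of `t² Z t`, its inversion integral converges absolutely and can be moved from `Re
z = 1` to `Re z = -γ`, which yields the factor `e^{-γt}` (`decaysExponentially_of_laplace`). -/

noncomputable section

namespace KuramotoDaido

/-! ### Linear differential equations in a Banach algebra -/

section LinearODE

variable {𝔸 : Type*} [NormedRing 𝔸] [NormedAlgebra ℝ 𝔸]

/-- The terms of the Picard (time-ordered exponential) series of `V' = A(t) V`, `V(0) = 1`. -/
def picardTerm (A : ℝ → 𝔸) : ℕ → ℝ → 𝔸
  | 0 => fun _ => 1
  | n + 1 => fun t => ∫ s in (0 : ℝ)..t, A s * picardTerm A n s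

lemma picardTerm_zero (A : ℝ → 𝔸) (t : ℝ) : picardTerm A 0 t = 1 := rfl

lemma picardTerm_succ_apply_zero (A : ℝ → 𝔸) (n : ℕ) : picardTerm A (n + 1) 0 = 0 :=
  intervalIntegral.integral_same

lemma continuous_picardTerm {A : ℝ → 𝔸} (hA : Continuous A) (n : ℕ) :
    Continuous (picardTerm A n) := by
  induction n with
  | zero => exact continuous_const
  | succ n ih =>
    exact intervalIntegral.continuous_primitive
      (fun a b => (hA.mul ih).intervalIntegrable a b) 0

lemma hasDerivAt_picardTerm_succ [CompleteSpace 𝔸] {A : ℝ → 𝔸} (hA : Continuous A) (n : ℕ) (t : ℝ) :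
    HasDerivAt (picardTerm A (n + 1)) (A t * picardTerm A n t) t :=
  intervalIntegral.integral_hasDerivAt_right
    ((hA.mul (continuous_picardTerm hA n)).intervalIntegrable _ _)
    ((hA.mul (continuous_picardTerm hA n)).stronglyMeasurableAtFilter _ _)
    (hA.mul (continuous_picardTerm hA n)).continuousAt

/-- The iterated integral runs over a simplex of volume `|t|^n / n!`. Both signs of `t` are needed,
since the solution is constructed on all of `ℝ`. -/
lemma norm_picardTerm_le {A : ℝ → 𝔸} {b : ℝ} (hb : ∀ t, ‖A t‖ ≤ b)
    (n : ℕ) (t : ℝ) : ‖picardTerm A n t‖ ≤ ‖(1 : 𝔸)‖ * ((b * |t|) ^ n / n.factorial) := by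
  have hb0 : 0 ≤ b := (norm_nonneg _).trans (hb 0)
  induction n generalizing t with
  | zero => simp [picardTerm]
  | succ n ih =>
    have h : ∀ s, ‖A s * picardTerm A n s‖ ≤
        ‖(1 : 𝔸)‖ * b ^ (n + 1) / n.factorial * |s| ^ n := fun s => by
      refine (norm_mul_le _ _).trans ((mul_le_mul (hb s) (ih s) (norm_nonneg _) hb0).trans_eq ?_)
      rw [mul_pow]; ring
    refine (intervalIntegral.norm_integral_le_abs_of_norm_le (μ := volume)
      (g := fun s => ‖(1 : 𝔸)‖ * b ^ (n + 1) / n.factorial * |s| ^ n)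
      (Eventually.of_forall fun s => h s) (by apply Continuous.intervalIntegrable; fun_prop)).trans
      ?_
    rw [intervalIntegral.integral_const_mul]
    have key : |∫ s in (0 : ℝ)..t, |s| ^ n| = |t| ^ (n + 1) / (n + 1) := by
      rcases le_total 0 t with ht | ht
      · rw [intervalIntegral.integral_congr (g := fun s => s ^ n)]
        · rw [integral_pow]
          simp only [ne_eq, Nat.succ_ne_zero, not_false_eq_true, zero_pow, sub_zero, abs_div, abs_pow]
          rw [abs_of_pos (by positivity : (0 : ℝ) < (n : ℝ) + 1)]
        · intro s hs
          rw [Set.uIcc_of_le ht] at hs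
          simp [abs_of_nonneg hs.1]
      · rw [intervalIntegral.integral_congr (g := fun s => (-1) ^ n * s ^ n)]
        · rw [intervalIntegral.integral_const_mul, integral_pow]
          simp only [ne_eq, Nat.succ_ne_zero, not_false_eq_true, zero_pow, sub_zero, abs_div, abs_pow,
            abs_mul, abs_neg, abs_one, one_pow, one_mul]
          rw [abs_of_pos (by positivity : (0 : ℝ) < (n : ℝ) + 1)]
        · intro s hs
          rw [Set.uIcc_of_ge ht] at hs
          simp only [abs_of_nonpos hs.2, ← mul_pow, neg_one_mul]
    rw [abs_mul, key, abs_of_nonneg (by positivity), Nat.factorial_succ]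
    apply le_of_eq
    push_cast
    rw [mul_pow]
    field_simp

/-- The linear equation `V' = A(t) V` with bounded continuous coefficient has a global solution. -/
theorem exists_fundamental_solution [CompleteSpace 𝔸] {A : ℝ → 𝔸} (hA : Continuous A) {b : ℝ}
    (hb : ∀ t, ‖A t‖ ≤ b) :
    ∃ V : ℝ → 𝔸, V 0 = 1 ∧ ∀ t, HasDerivAt V (A t * V t) t := by
  have hb0 : 0 ≤ b := (norm_nonneg _).trans (hb 0)
  have hsum : ∀ t, Summable fun n => picardTerm A n t := fun t =>
    Summable.of_norm_bounded ((Real.summable_pow_div_factorial (b * |t|)).mul_left _)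
      (norm_picardTerm_le hb · t)
  have hz := picardTerm_succ_apply_zero A
  have hfun : ∀ t, ∑' n, picardTerm A n t = 1 + ∑' n, picardTerm A (n + 1) t := fun t => by
    rw [(hsum t).tsum_eq_zero_add, picardTerm_zero]
  refine ⟨fun t => ∑' n, picardTerm A n t, ?_, fun t => ?_⟩
  · simp only [hfun, hz, tsum_zero, add_zero]
  have hV : A t * ∑' n, picardTerm A n t = ∑' n, A t * picardTerm A n t :=
    ((hsum t).tsum_mul_left _).symm
  simp only [hV]
  simp only [hfun]
  refine HasDerivAt.const_add 1 ?_
  -- Termwise differentiation takes place on a ball containing both `t` and `0`. At `0` every term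
  -- of the shifted series vanishes, which gives the required convergence at one point.
  set R := |t| + 1
  have hR : |t| < R := lt_add_one _
  refine hasDerivAt_tsum_of_isPreconnected (g := fun n t => picardTerm A (n + 1) t)
    (g' := fun n t => A t * picardTerm A n t) (y₀ := 0) (y := t) (t := Metric.ball (0 : ℝ) R)
    (u := fun n => b * (‖(1 : 𝔸)‖ * ((b * R) ^ n / n.factorial)))
    (((Real.summable_pow_div_factorial (b * R)).mul_left _).mul_left _)
    Metric.isOpen_ball (convex_ball _ _).isPreconnected
    (fun n s _ => hasDerivAt_picardTerm_succ hA n s) (fun n s hs => ?_)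
    (Metric.mem_ball_self (by positivity)) ?_ ?_
  · have hs' : |s| ≤ R := by simpa using (Metric.mem_ball.1 hs).le
    refine (norm_mul_le _ _).trans (mul_le_mul (hb s) ((norm_picardTerm_le hb n s).trans ?_)
      (norm_nonneg _) hb0)
    gcongr
  · simp only [hz, summable_zero]
  · simpa using hR

end LinearODE

/-! ### The unitary group of the multiplication operator -/

/-- Dominated convergence in `L²`. -/
lemma tendsto_L2_of_dominated {α ι : Type*} [MeasurableSpace α] {μ : Measure α} {l : Filter ι}
    [l.IsCountablyGenerated] {F : ι → Lp ℂ 2 μ} {f : Lp ℂ 2 μ} (G : ι → α → ℂ) {b : α → ℝ}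
    (hG : ∀ i, F i =ᵐ[μ] G i) (hb : MemLp b 2 μ)
    (hbound : ∀ᶠ i in l, ∀ᵐ a ∂μ, ‖G i a - f a‖ ≤ b a)
    (hlim : ∀ᵐ a ∂μ, Tendsto (fun i => G i a) l (𝓝 (f a))) : Tendsto F l (𝓝 f) := by
  rw [Lp.tendsto_Lp_iff_tendsto_eLpNorm']
  have h2 : (2 : ENNReal) ≠ 0 := by norm_num
  have h2' : (2 : ENNReal) ≠ ⊤ := by norm_num
  have key : Tendsto (fun i => ∫⁻ a, ‖G i a - f a‖ₑ ^ (2 : ENNReal).toReal ∂μ) l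
      (𝓝 (∫⁻ _, 0 ∂μ)) := by
    refine tendsto_lintegral_filter_of_dominated_convergence'
      (fun a => ‖b a‖ₑ ^ (2 : ENNReal).toReal) (Eventually.of_forall fun i => ?_) ?_ ?_ ?_
    · exact ((((Lp.aestronglyMeasurable (F i)).congr (hG i)).sub
        (Lp.aestronglyMeasurable f)).enorm).pow_const _
    · filter_upwards [hbound] with i hi
      filter_upwards [hi] with a ha
      gcongr
      rw [enorm_le_iff_norm_le]
      exact ha.trans (le_abs_self _)
    · exact ((eLpNorm_lt_top_iff_lintegral_rpow_enorm_lt_top h2 h2').1 hb.2).ne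
    · filter_upwards [hlim] with a ha
      have h0 : Tendsto (fun i => ‖G i a - f a‖ₑ) l (𝓝 0) := by
        have := (ha.sub_const (f a)).enorm
        simpa using this
      have := h0.ennrpow_const (2 : ENNReal).toReal
      simpa using this
  rw [lintegral_zero] at key
  have h3 := key.ennrpow_const (1 / (2 : ENNReal).toReal)
  have h4 : ∀ i, eLpNorm (⇑(F i) - ⇑f) 2 μ =
      (∫⁻ a, ‖G i a - f a‖ₑ ^ (2 : ENNReal).toReal ∂μ) ^ (1 / (2 : ENNReal).toReal) := fun i => by
    rw [eLpNorm_congr_ae ((hG i).sub (ae_eq_refl f)),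
      eLpNorm_eq_lintegral_rpow_enorm_toReal h2 h2']
    rfl
  simp only [h4]
  simpa using h3

lemma memLp_exp_mul (g : ProbDensity) (t : ℝ) (u : g.L2) :
    MemLp (fun ω : ℝ => cexp (I * ω * t) * u ω) 2 g.measure := by
  refine (Lp.memLp u).of_le_mul (c := 1)
    ((by fun_prop : Continuous fun ω : ℝ => cexp (I * ω * t)).aestronglyMeasurable.mul
      (Lp.aestronglyMeasurable u)) (Eventually.of_forall fun ω => ?_)
  rw [norm_mul, Complex.norm_exp]
  simp

/-- The unitary group `e^{iMt}`: multiplication by `e^{iωt}`. -/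
def flow (g : ProbDensity) (t : ℝ) : g.L2 →L[ℂ] g.L2 :=
  LinearMap.mkContinuous
    { toFun := fun u => (memLp_exp_mul g t u).toLp
      map_add' := by
        intro u v
        rw [← MemLp.toLp_add]
        refine MemLp.toLp_congr _ _ ?_
        filter_upwards [Lp.coeFn_add u v] with ω h
        exact (congrArg (fun z => cexp (I * ω * t) * z) h).trans (mul_add _ _ _)
      map_smul' := by
        intro c u
        rw [RingHom.id_apply, ← MemLp.toLp_const_smul]
        refine MemLp.toLp_congr _ _ ?_
        filter_upwards [Lp.coeFn_smul c u] with ω h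
        simp [h, mul_left_comm] } 1 (by
    intro u
    refine Lp.norm_le_mul_norm_of_ae_le_mul ?_
    filter_upwards [MemLp.coeFn_toLp (memLp_exp_mul g t u)] with ω h
    simp only [LinearMap.coe_mk, AddHom.coe_mk, h, norm_mul, Complex.norm_exp]
    simp)

lemma flow_coeFn (g : ProbDensity) (t : ℝ) (u : g.L2) :
    flow g t u =ᵐ[g.measure] fun ω : ℝ => cexp (I * ω * t) * u ω :=
  MemLp.coeFn_toLp (memLp_exp_mul g t u)

lemma flow_zero (g : ProbDensity) : flow g 0 = 1 := by
  ext1 u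
  refine Lp.ext ?_
  filter_upwards [flow_coeFn g 0 u] with ω h
  simp [h]

lemma flow_add (g : ProbDensity) (s t : ℝ) : flow g (s + t) = flow g s * flow g t := by
  ext1 u
  refine Lp.ext ?_
  filter_upwards [flow_coeFn g (s + t) u, flow_coeFn g s (flow g t u), flow_coeFn g t u]
    with ω h1 h2 h3
  rw [mul_apply_eq_comp, h1, h2, h3, ← mul_assoc, ← Complex.exp_add]
  push_cast
  ring_nf

lemma norm_flow_apply_le (g : ProbDensity) (t : ℝ) (u : g.L2) : ‖flow g t u‖ ≤ ‖u‖ := by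
  refine (LinearMap.mkContinuous_norm_le _ zero_le_one _ |> (flow g t).le_of_opNorm_le <| u).trans ?_
  rw [one_mul]

lemma inner_flow (g : ProbDensity) (t : ℝ) (u v : g.L2) :
    inner ℂ u (flow g t v) = inner ℂ (flow g (-t) u) v := by
  rw [L2.inner_def, L2.inner_def]
  refine integral_congr_ae ?_
  filter_upwards [flow_coeFn g t v, flow_coeFn g (-t) u] with ω h1 h2
  rw [h1, h2, RCLike.inner_apply, RCLike.inner_apply, map_mul, ← Complex.exp_conj]
  have : (starRingEnd ℂ) (I * ω * ((-t : ℝ) : ℂ)) = I * ω * t := by simp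
  rw [this]
  ring

lemma norm_flow_apply (g : ProbDensity) (t : ℝ) (u : g.L2) : ‖flow g t u‖ = ‖u‖ := by
  refine le_antisymm (norm_flow_apply_le g t u) ?_
  have h : u = flow g (-t) (flow g t u) := by
    rw [← mul_apply_eq_comp, ← flow_add, neg_add_cancel, flow_zero,
      one_apply_eq_self]
  calc ‖u‖ = ‖flow g (-t) (flow g t u)‖ := by rw [← h]
    _ ≤ _ := norm_flow_apply_le g _ _

lemma norm_exp_I_mul_sub_one_le (ω h : ℝ) : ‖cexp (I * ω * h) - 1‖ ≤ |ω| * |h| := by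
  have := Real.norm_exp_I_mul_ofReal_sub_one_le (x := ω * h)
  rw [Real.norm_eq_abs, abs_mul] at this
  refine le_of_eq_of_le ?_ this
  push_cast
  ring_nf

lemma continuous_flow_apply (g : ProbDensity) (u : g.L2) : Continuous fun t => flow g t u := by
  refine continuous_iff_continuousAt.2 fun t => ?_
  refine tendsto_L2_of_dominated (fun s (ω : ℝ) => cexp (I * ω * s) * u ω)
    (b := fun ω => 2 * ‖u ω‖)
    (fun s => flow_coeFn g s u) ((Lp.memLp u).norm.const_mul 2)
    (Eventually.of_forall fun s => ?_) ?_
  · filter_upwards [flow_coeFn g t u] with ω h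
    rw [h]
    refine (norm_sub_le _ _).trans ?_
    rw [norm_mul, norm_mul, Complex.norm_exp, Complex.norm_exp]
    simp [two_mul]
  · filter_upwards [flow_coeFn g t u] with ω h
    rw [h]
    exact (by fun_prop : Continuous fun s : ℝ => cexp (I * ω * s) * u ω).tendsto t

lemma tendsto_exp_sub_one_div (ω : ℝ) (z : ℂ) :
    Tendsto (fun h : ℝ => ((h⁻¹ : ℝ) : ℂ) * (cexp (I * ω * h) * z - z)) (𝓝[>] 0)
      (𝓝 (I * (ω * z))) := by
  have h1 : HasDerivAt (fun h : ℝ => cexp (I * ω * h) * z) (I * (ω * z)) 0 := by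
    have := (((hasDerivAt_id (0 : ℂ)).const_mul (I * ω)).cexp.mul_const z).comp_ofReal (z := 0)
    simpa [mul_assoc] using this
  have h2 := h1.hasDerivWithinAt (s := Set.Ioi 0)
  rw [hasDerivWithinAt_iff_tendsto_slope' (by simp)] at h2
  refine h2.congr fun h => ?_
  simp [slope_def_module]

lemma mem_mulOp_domain {g : ProbDensity} {u : g.L2} :
    u ∈ (mulOp g).domain ↔ MemLp (fun ω : ℝ => (ω : ℂ) * u ω) 2 g.measure := Iff.rfl

lemma mulOp_coeFn (g : ProbDensity) (u : (mulOp g).domain) :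
    mulOp g u =ᵐ[g.measure] fun ω : ℝ => (ω : ℂ) * (u : g.L2) ω :=
  MemLp.coeFn_toLp u.2

lemma diffQuot_coeFn (g : ProbDensity) (u : g.L2) (h : ℝ) :
    ⇑(((h⁻¹ : ℝ) : ℂ) • (flow g h u - u)) =ᵐ[g.measure]
      fun ω : ℝ => ((h⁻¹ : ℝ) : ℂ) * (cexp (I * ω * h) * u ω - u ω) := by
  filter_upwards [Lp.coeFn_smul ((h⁻¹ : ℝ) : ℂ) (flow g h u - u), Lp.coeFn_sub (flow g h u) u,
    flow_coeFn g h u] with ω h1 h2 h3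
  rw [h1, Pi.smul_apply, h2, Pi.sub_apply, h3, smul_eq_mul]

/-- The generator of the unitary group `flow` is `iM`. -/
lemma flow_generator (g : ProbDensity) (u v : g.L2) :
    (∃ hu : u ∈ (mulOp g).domain, I • mulOp g ⟨u, hu⟩ = v) ↔
    Tendsto (fun h : ℝ => ((h⁻¹ : ℝ) : ℂ) • (flow g h u - u)) (𝓝[>] 0) (𝓝 v) := by
  constructor
  · rintro ⟨hu, rfl⟩
    have hv : ⇑(I • mulOp g ⟨u, hu⟩) =ᵐ[g.measure] fun ω : ℝ => I * ((ω : ℂ) * u ω) := by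
      filter_upwards [Lp.coeFn_smul I (mulOp g ⟨u, hu⟩), mulOp_coeFn g ⟨u, hu⟩] with ω h1 h2
      rw [h1, Pi.smul_apply, h2, smul_eq_mul]
    refine tendsto_L2_of_dominated
      (fun (h : ℝ) (ω : ℝ) => ((h⁻¹ : ℝ) : ℂ) * (cexp (I * ω * h) * u ω - u ω))
      (b := fun ω => 2 * ‖(ω : ℂ) * u ω‖)
      (diffQuot_coeFn g u) ((mem_mulOp_domain.1 hu).norm.const_mul 2) ?_ ?_
    · filter_upwards [self_mem_nhdsWithin] with h (hh : 0 < h)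
      filter_upwards [hv] with ω h1
      rw [h1]
      refine (norm_sub_le _ _).trans ?_
      rw [two_mul]
      refine add_le_add ?_ (by simp)
      rw [← sub_one_mul, ← mul_assoc, norm_mul, norm_mul, norm_mul]
      refine mul_le_mul_of_nonneg_right ?_ (norm_nonneg _)
      rw [norm_real, norm_real, Real.norm_eq_abs, Real.norm_eq_abs, abs_inv]
      refine (mul_le_mul_of_nonneg_left (norm_exp_I_mul_sub_one_le ω h) (by positivity)).trans ?_
      have : |h| ≠ 0 := by simpa using hh.ne'
      field_simp
      rfl
    · filter_upwards [hv] with ω h1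
      rw [h1]
      exact tendsto_exp_sub_one_div ω (u ω)
  · intro h
    -- Along a sequence the `L²` limit is also an almost everywhere limit, so `v` must be `iωu(ω)`.
    -- This puts `ωu(ω)` in `L²`.
    obtain ⟨ns, hns, hae⟩ := (tendstoInMeasure_of_tendsto_Lp h).exists_seq_tendsto_ae'
    have hseq := ae_all_iff.2 fun n => diffQuot_coeFn g u (ns n)
    have hv : v =ᵐ[g.measure] fun ω : ℝ => I * ((ω : ℂ) * u ω) := by
      filter_upwards [hae, hseq] with ω h1 h2
      simp only [h2] at h1
      exact tendsto_nhds_unique h1 ((tendsto_exp_sub_one_div ω (u ω)).comp hns)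
    have hu : MemLp (fun ω : ℝ => (ω : ℂ) * u ω) 2 g.measure := by
      refine (memLp_congr_ae ?_).2 ((Lp.memLp v).const_mul (-I))
      filter_upwards [hv] with ω h1
      rw [h1, ← mul_assoc, neg_mul, I_mul_I, neg_neg, one_mul]
    refine ⟨hu, Lp.ext ?_⟩
    filter_upwards [hv, Lp.coeFn_smul I (mulOp g ⟨u, hu⟩), mulOp_coeFn g ⟨u, hu⟩] with ω h1 h2 h3
    rw [h1, h2, Pi.smul_apply, h3, smul_eq_mul]

lemma mulOp_domain_dense (g : ProbDensity) : Dense ((mulOp g).domain : Set g.L2) := by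
  refine Metric.dense_iff.2 fun u r hr => ?_
  obtain ⟨f, hf, hfu, hfc, hfm⟩ := (Lp.memLp u).exists_hasCompactSupport_eLpNorm_sub_le
    (by norm_num) (ε := ENNReal.ofReal (r / 2)) (by simpa using hr)
  refine ⟨hfm.toLp f, ?_, ?_⟩
  · rw [Metric.mem_ball, dist_comm, Lp.dist_def,
      eLpNorm_congr_ae ((ae_eq_refl u).sub (MemLp.coeFn_toLp hfm))]
    refine (ENNReal.toReal_mono (by simp) hfu).trans_lt ?_
    rw [ENNReal.toReal_ofReal (by positivity)]
    linarith
  · refine mem_mulOp_domain.2 ((memLp_congr_ae ?_).2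
      (Continuous.memLp_of_hasCompactSupport (f := fun ω : ℝ => (ω : ℂ) * f ω)
        (by fun_prop) hf.mul_left))
    filter_upwards [MemLp.coeFn_toLp hfm] with ω h1
    rw [h1]

/-! ### Generation: the rank-one perturbation in the interaction picture -/

lemma mem_T1_graph_iff {g : ProbDensity} {K : ℝ} {f₁ : ℂ} {x y : g.L2} :
    (x, y) ∈ (T1 g K f₁).graph ↔ ∃ hx : x ∈ (mulOp g).domain,
      (I * K * f₁) • (inner ℂ (P0 g) x • P0 g) + I • mulOp g ⟨x, hx⟩ = y := by
  rw [LinearPMap.mem_graph_iff]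
  constructor
  · rintro ⟨⟨z, hz⟩, rfl, rfl⟩
    exact ⟨hz, rfl⟩
  · rintro ⟨hx, rfl⟩
    exact ⟨⟨x, hx⟩, rfl, rfl⟩

lemma continuous_rankOne_self {X H : Type*} [TopologicalSpace X] [NormedAddCommGroup H]
    [InnerProductSpace ℂ H] {p : X → H} (hp : Continuous p) :
    Continuous fun x => InnerProductSpace.rankOne ℂ (p x) (p x) :=
  (ContinuousLinearMap.continuous₂ (ContinuousLinearMap.smulRightL ℂ H H)).comp
    (((innerSL ℂ (E := H)).continuous.comp hp).prodMk hp)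

section Construction

variable (g : ProbDensity) (c : ℂ)

/-- The perturbation `c P` in the interaction picture, `e^{-iMt} (c P) e^{iMt}`. -/
def interactionOp (t : ℝ) : g.L2 →L[ℂ] g.L2 :=
  c • InnerProductSpace.rankOne ℂ (flow g (-t) (P0 g)) (flow g (-t) (P0 g))

lemma interactionOp_apply (t : ℝ) (x : g.L2) : interactionOp g c t x =
    c • (inner ℂ (P0 g) (flow g t x) • flow g (-t) (P0 g)) := by
  rw [inner_flow]
  rfl

/-- The flow is only strongly continuous, but a rank-one operator depends on its two vectors
continuously in norm. Hence the interaction equation can be solved in operator norm. -/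
lemma continuous_interactionOp : Continuous (interactionOp g c) := by
  have h : Continuous fun t : ℝ => flow g (-t) (P0 g) :=
    (continuous_flow_apply g (P0 g)).comp continuous_neg
  exact (continuous_rankOne_self h).const_smul c

lemma norm_interactionOp_le (t : ℝ) : ‖interactionOp g c t‖ ≤ ‖c‖ * (‖P0 g‖ * ‖P0 g‖) := by
  rw [interactionOp, norm_smul, InnerProductSpace.norm_rankOne, norm_flow_apply]

/-- Conjugation by the flow shifts time. This is what turns the solution `V` of the interaction
equation into a semigroup `flow g t * V t`. -/
lemma interactionOp_add_flow (s t : ℝ) :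
    flow g t * interactionOp g c (s + t) = interactionOp g c s * flow g t := by
  ext1 x
  simp only [mul_apply_eq_comp, interactionOp_apply, map_smul]
  rw [← mul_apply_eq_comp, ← mul_apply_eq_comp, ← flow_add, ← flow_add]
  ring_nf

end Construction

/-- `T₁` generates a strongly continuous semigroup. -/
theorem exists_semigroup (g : ProbDensity) (K : ℝ) (f₁ : ℂ) :
    ∃ S : C0Semigroup g.L2, S.IsGeneratedBy (T1 g K f₁) := by
  set c : ℂ := I * K * f₁ with hc
  obtain ⟨V, hV0, hV⟩ := exists_fundamental_solution (continuous_interactionOp g c)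
    (norm_interactionOp_le g c)
  have hVc : Continuous V := continuous_iff_continuousAt.2 fun t => (hV t).continuousAt
  have hjoint : Continuous fun p : ℝ × g.L2 => flow g p.1 p.2 := by
    refine continuous_iff_continuousAt.2 fun p => ?_
    have h1 : Tendsto (fun q : ℝ × g.L2 => flow g q.1 (q.2 - p.2) + flow g q.1 p.2) (𝓝 p)
        (𝓝 (0 + flow g p.1 p.2)) := by
      refine Tendsto.add (squeeze_zero_norm (a := fun q : ℝ × g.L2 => ‖q.2 - p.2‖)
        (fun q => norm_flow_apply_le _ _ _) ?_)
        (((continuous_flow_apply g p.2).comp continuous_fst).tendsto p)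
      have : Continuous fun q : ℝ × g.L2 => ‖q.2 - p.2‖ := by fun_prop
      simpa using this.tendsto p
    simpa [ContinuousAt] using h1
  -- As functions of `s`, both sides solve `X' = A(s) X` with the same value at `s = 0`, so
  -- uniqueness identifies them.
  have hadd : ∀ s t, flow g t * V (s + t) = V s * (flow g t * V t) := fun s t => by
    have hY : ∀ s, HasDerivAt (fun s => flow g t * V (s + t))
        (interactionOp g c s * (flow g t * V (s + t))) s := fun s => by
      have h1 : HasDerivAt (fun s => V (s + t)) (interactionOp g c (s + t) * V (s + t)) s :=
        HasDerivAt.comp_add_const s t (hV (s + t))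
      have h2 := h1.const_mul (flow g t)
      rwa [← mul_assoc, interactionOp_add_flow, mul_assoc] at h2
    have hW : ∀ s, HasDerivAt (fun s => V s * (flow g t * V t))
        (interactionOp g c s * (V s * (flow g t * V t))) s := fun s => by
      have h2 := (hV s).mul_const (flow g t * V t)
      rwa [mul_assoc] at h2
    have huniq := ODE_solution_unique_univ (t₀ := 0)
      (v := fun s X => interactionOp g c s * X) (s := fun _ => Set.univ)
      (K := (‖c‖ * (‖P0 g‖ * ‖P0 g‖)).toNNReal)
      (fun s => LipschitzOnWith.of_dist_le_mul fun X _ Y _ => by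
        rw [dist_eq_norm, dist_eq_norm, ← mul_sub, Real.coe_toNNReal _ (by positivity)]
        exact (norm_mul_le _ _).trans
          (mul_le_mul_of_nonneg_right (norm_interactionOp_le g c s) (norm_nonneg _)))
      (fun s => ⟨hY s, trivial⟩) (fun s => ⟨hW s, trivial⟩) (by simp [hV0])
    exact congrFun huniq s
  let S : C0Semigroup g.L2 :=
    { toFun := fun t => flow g t * V t
      map_zero := by rw [hV0, flow_zero, mul_one]; rfl
      map_add := fun s t _ _ => by
        rw [flow_add, mul_assoc, hadd, ← mul_assoc]
        rfl
      continuousOn := fun x => Continuous.continuousOn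
        (hjoint.comp (continuous_id.prodMk (hVc.clm_apply continuous_const))) }
  refine ⟨S, fun x y => ?_⟩
  have hlim : Tendsto (fun h : ℝ => flow g h (((h⁻¹ : ℝ) : ℂ) • (V h x - x))) (𝓝[>] 0)
      (𝓝 (c • (inner ℂ (P0 g) x • P0 g))) := by
    have h1 : HasDerivAt (fun h => V h x) (interactionOp g c 0 x) 0 := by
      have := ((ContinuousLinearMap.apply ℂ g.L2 x).restrictScalars ℝ).hasFDerivAt.comp_hasDerivAt
        (0 : ℝ) (hV 0)
      simpa [hV0, Function.comp_def] using this
    have h2 := h1.hasDerivWithinAt (s := Set.Ioi 0)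
    rw [hasDerivWithinAt_iff_tendsto_slope' (by simp)] at h2
    have h3 : Tendsto (fun h : ℝ => ((h⁻¹ : ℝ) : ℂ) • (V h x - x)) (𝓝[>] 0)
        (𝓝 (interactionOp g c 0 x)) := by
      refine h2.congr fun h => ?_
      simp only [slope_def_module, sub_zero, hV0, one_apply_eq_self]
      rfl
    have h4 := (hjoint.tendsto (0, interactionOp g c 0 x)).comp
      ((tendsto_nhdsWithin_of_tendsto_nhds tendsto_id).prodMk_nhds h3)
    simpa [Function.comp_def, flow_zero, interactionOp_apply] using h4
  -- The first summand converges for every `x` by `hlim`. So the quotient of `S` converges exactly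
  -- when that of the flow does, and the domain is that of `M`.
  have hsplit : ∀ h : ℝ, ((h⁻¹ : ℝ) : ℂ) • (S.toFun h x - x) =
      flow g h (((h⁻¹ : ℝ) : ℂ) • (V h x - x)) + ((h⁻¹ : ℝ) : ℂ) • (flow g h x - x) := fun h => by
    change ((h⁻¹ : ℝ) : ℂ) • (flow g h (V h x) - x) = _
    rw [map_smul, map_sub, ← smul_add, sub_add_sub_cancel]
  simp only [hsplit]
  rw [mem_T1_graph_iff, ← hc]
  have hiff := flow_generator g x (y - c • (inner ℂ (P0 g) x • P0 g))
  constructor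
  · rintro ⟨hx, rfl⟩
    exact hlim.add (hiff.1 ⟨hx, by abel⟩ |>.congr fun _ => rfl) |>.trans (by simp)
  · intro h
    obtain ⟨hx, h'⟩ := hiff.2 ((h.sub hlim).congr fun _ => by abel)
    exact ⟨hx, by rw [h']; abel⟩

/-! ### Contraction and Laplace transform for abstract semigroups -/

section Semigroup

variable {H : Type*} [NormedAddCommGroup H]

lemma C0Semigroup.mem_graph [NormedSpace ℂ H] {S : C0Semigroup H} {T : H →ₗ.[ℂ] H}
    (hS : S.IsGeneratedBy T) {x y : H} (hxy : (x, y) ∈ T.graph) {t : ℝ} (ht : 0 ≤ t) :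
    (S.toFun t x, S.toFun t y) ∈ T.graph := by
  rw [hS]
  refine (((S.toFun t).continuous.tendsto y).comp ((hS x y).1 hxy)).congr' ?_
  filter_upwards [self_mem_nhdsWithin] with h (hh : 0 < h)
  simp only [Function.comp_apply, map_smul, map_sub]
  rw [← ContinuousLinearMap.comp_apply, ← ContinuousLinearMap.comp_apply, ← S.map_add t h ht hh.le,
    ← S.map_add h t hh.le ht, add_comm]

/-- The generator is defined by limits `h → 0+`, so only a right derivative comes for free. It
suffices for the fundamental theorem of calculus and for the monotonicity argument below. -/
lemma C0Semigroup.hasDerivWithinAt [NormedSpace ℂ H] {S : C0Semigroup H} {T : H →ₗ.[ℂ] H}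
    (hS : S.IsGeneratedBy T) {x y : H} (hxy : (x, y) ∈ T.graph) {t : ℝ} (ht : 0 ≤ t) :
    HasDerivWithinAt (fun s => S.toFun s x) (S.toFun t y) (Set.Ioi t) t := by
  rw [hasDerivWithinAt_iff_tendsto_slope' (by simp)]
  have h1 := (hS _ _).1 (C0Semigroup.mem_graph hS hxy ht)
  have h2 : Tendsto (fun s : ℝ => s - t) (𝓝[>] t) (𝓝[>] 0) := by
    refine tendsto_nhdsWithin_iff.2 ⟨?_, ?_⟩
    · have : Tendsto (fun s : ℝ => s - t) (𝓝 t) (𝓝 (t - t)) :=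
        (continuous_id.sub continuous_const).tendsto t
      rw [sub_self] at this
      exact tendsto_nhdsWithin_of_tendsto_nhds this
    · filter_upwards [self_mem_nhdsWithin] with s (hs : t < s)
      simpa using hs
  refine (h1.comp h2).congr' ?_
  filter_upwards [self_mem_nhdsWithin] with s (hs : t < s)
  simp only [Function.comp_apply, slope_def_module]
  rw [← ContinuousLinearMap.comp_apply, ← S.map_add (s - t) t (by linarith) ht, sub_add_cancel]
  rfl

/-- The Laplace transform of a contraction semigroup is the resolvent of the generator. -/
lemma C0Semigroup.laplace_eq [NormedSpace ℂ H] {S : C0Semigroup H} {T : H →ₗ.[ℂ] H}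
    (hS : S.IsGeneratedBy T) (hc : ∀ t, 0 ≤ t → ∀ x, ‖S.toFun t x‖ ≤ ‖x‖) (L : H →L[ℂ] ℂ)
    {z : ℂ} (hz : 0 < z.re) {x y : H} (hxy : (x, y) ∈ T.graph) :
    ∫ t in Set.Ioi (0 : ℝ), cexp (-(z * t)) * L (S.toFun t (z • x - y)) = L x := by
  set w : H := z • x - y with hw
  have hLS : ∀ v, ContinuousOn (fun t : ℝ => cexp (-(z * t)) * L (S.toFun t v)) (Set.Ici 0) :=
    fun v => (by fun_prop : Continuous fun t : ℝ => cexp (-(z * t))).continuousOn.mul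
      (L.continuous.comp_continuousOn (S.continuousOn v))
  have hbound : ∀ v, ∀ t : ℝ, 0 ≤ t →
      ‖cexp (-(z * t)) * L (S.toFun t v)‖ ≤ ‖L‖ * ‖v‖ * Real.exp (-z.re * t) := fun v t ht => by
    rw [norm_mul, Complex.norm_exp, mul_comm]
    have h1 : (-(z * t)).re = -z.re * t := by simp
    rw [h1]
    gcongr
    exact (L.le_opNorm _).trans (by gcongr; exact hc t ht v)
  have hinteg : IntegrableOn (fun t : ℝ => cexp (-(z * t)) * L (S.toFun t w)) (Set.Ioi 0) := by
    refine Integrable.mono' ((exp_neg_integrableOn_Ioi 0 hz).const_mul (‖L‖ * ‖w‖))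
      (((hLS w).mono Set.Ioi_subset_Ici_self).aestronglyMeasurable measurableSet_Ioi) ?_
    filter_upwards [ae_restrict_mem measurableSet_Ioi] with t ht
    exact hbound w t (le_of_lt ht)
  -- The integrand is minus the right derivative of `e^{-zt} L(S t x)`.
  have hFTC : ∀ R : ℝ, 0 ≤ R → ∫ t in (0 : ℝ)..R, cexp (-(z * t)) * L (S.toFun t w) =
      L x - cexp (-(z * R)) * L (S.toFun R x) := fun R hR => by
    have := intervalIntegral.integral_eq_sub_of_hasDeriv_right_of_le hR
      (f := fun t : ℝ => -(cexp (-(z * t)) * L (S.toFun t x)))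
      (f' := fun t : ℝ => cexp (-(z * t)) * L (S.toFun t w))
      ((hLS x).mono Set.Icc_subset_Ici_self).neg (fun t ht => ?_)
      (((hLS w).mono (by rw [Set.uIcc_of_le hR]; exact Set.Icc_subset_Ici_self)).intervalIntegrable)
    · rw [this]
      simp [S.map_zero]
      ring
    · have h1 : HasDerivWithinAt (fun t : ℝ => cexp (-(z * t))) (cexp (-(z * t)) * (-z))
          (Set.Ioi t) t := by
        have := ((hasDerivAt_id (t : ℂ)).const_mul z).neg.cexp.comp_ofReal
        simpa using this.hasDerivWithinAt
      have h2 := (L.restrictScalars ℝ).hasFDerivAt.comp_hasDerivWithinAt t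
        (C0Semigroup.hasDerivWithinAt hS hxy ht.1.le)
      refine ((h1.mul h2).neg).congr_deriv ?_
      simp only [hw, map_sub, map_smul, Function.comp_apply, ContinuousLinearMap.coe_restrictScalars',
        smul_eq_mul]
      ring
  have hlim : Tendsto (fun R : ℝ => L x - cexp (-(z * R)) * L (S.toFun R x)) atTop
      (𝓝 (L x - 0)) := by
    refine tendsto_const_nhds.sub (squeeze_zero_norm'
      (a := fun t => ‖L‖ * ‖x‖ * Real.exp (-z.re * t)) ?_ ?_)
    · filter_upwards [eventually_ge_atTop 0] with t ht using hbound x t ht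
    · have : Tendsto (fun t : ℝ => Real.exp (-z.re * t)) atTop (𝓝 0) := by
        refine Real.tendsto_exp_atBot.comp ?_
        exact tendsto_id.const_mul_atTop_of_neg (by simpa using hz)
      simpa using this.const_mul (‖L‖ * ‖x‖)
  rw [sub_zero] at hlim
  refine tendsto_nhds_unique ((intervalIntegral_tendsto_integral_Ioi 0 hinteg tendsto_id).congr' ?_)
    hlim
  filter_upwards [eventually_ge_atTop 0] with R hR using hFTC R hR

variable [InnerProductSpace ℂ H]

/-- A semigroup with densely defined dissipative generator is contractive. -/
lemma C0Semigroup.norm_apply_le {S : C0Semigroup H} {T : H →ₗ.[ℂ] H}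
    (hS : S.IsGeneratedBy T) (hT : ∀ x y, (x, y) ∈ T.graph → (inner ℂ x y).re ≤ 0)
    (hd : Dense (T.domain : Set H)) {t : ℝ} (ht : 0 ≤ t) (x : H) : ‖S.toFun t x‖ ≤ ‖x‖ := by
  let _ : InnerProductSpace ℝ H := InnerProductSpace.rclikeToReal ℂ H
  refine hd.induction (P := fun x => ‖S.toFun t x‖ ≤ ‖x‖) (fun x hx => ?_)
    (isClosed_le (by fun_prop) (by fun_prop)) x
  have hxy : (x, T ⟨x, hx⟩) ∈ T.graph := T.mem_graph ⟨x, hx⟩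
  have hcont : ContinuousOn (fun s => ‖S.toFun s x‖ ^ 2) (Set.Icc 0 t) :=
    ((S.continuousOn x).mono Set.Icc_subset_Ici_self).norm.pow 2
  -- The right derivative of `‖S s x‖²` is `2 Re (S s x, T S s x) ≤ 0`.
  have key := image_le_of_deriv_right_le_deriv_boundary (f := fun s => ‖S.toFun s x‖ ^ 2)
    (f' := fun s => 2 * inner ℝ (S.toFun s x) (S.toFun s (T ⟨x, hx⟩))) (a := 0) (b := t) hcont
    (fun s hs => (C0Semigroup.hasDerivWithinAt hS hxy hs.1).norm_sq.Ici_of_Ioi)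
    (B := fun _ => ‖x‖ ^ 2) (B' := fun _ => 0) (by simp [S.map_zero]) continuousOn_const
    (fun s _ => hasDerivWithinAt_const _ _ _)
    (fun s hs => by
      have := hT _ _ (C0Semigroup.mem_graph hS hxy hs.1)
      have h2 : inner ℝ (S.toFun s x) (S.toFun s (T ⟨x, hx⟩)) =
        (inner ℂ (S.toFun s x) (S.toFun s (T ⟨x, hx⟩))).re := rfl
      rw [h2]
      linarith) (Set.right_mem_Icc.2 ht)
  exact (sq_le_sq₀ (norm_nonneg _) (norm_nonneg _)).1 key

end Semigroup

/-! ### Dissipativity and the resolvent of `T₁` -/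

lemma P0_coeFn (g : ProbDensity) : P0 g =ᵐ[g.measure] fun _ => (1 : ℂ) :=
  Lp.coeFn_const 2 g.measure (1 : ℂ)

lemma inner_P0 (g : ProbDensity) (x : g.L2) : inner ℂ (P0 g) x = ∫ ω, x ω ∂g.measure := by
  rw [L2.inner_def]
  refine integral_congr_ae ?_
  filter_upwards [P0_coeFn g] with ω h
  rw [h, RCLike.inner_apply, map_one, mul_one]

lemma integral_measure (g : ProbDensity) (f : ℝ → ℂ) :
    ∫ ω, f ω ∂g.measure = ∫ ω, f ω * g ω := by
  rw [ProbDensity.measure, integral_withDensity_eq_integral_toReal_smul₀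
    g.integrable.aemeasurable.ennreal_ofReal (by simp)]
  refine integral_congr_ae (Eventually.of_forall fun ω => ?_)
  simp [ENNReal.toReal_ofReal (g.nonneg ω), mul_comm]

lemma integrable_measure_iff (g : ProbDensity) (f : ℝ → ℂ) :
    Integrable f g.measure ↔ Integrable fun ω => f ω * g ω := by
  rw [ProbDensity.measure, integrable_withDensity_iff_integrable_smul₀'
    g.integrable.aemeasurable.ennreal_ofReal (by simp)]
  refine integrable_congr (Eventually.of_forall fun ω => ?_)
  simp [ENNReal.toReal_ofReal (g.nonneg ω), mul_comm]

/-- `M` is symmetric, so `iM` contributes nothing to the real part. The perturbation contributes `-K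
Im f₁ |(x, P₀)|²`. -/
lemma T1_dissipative (g : ProbDensity) {K : ℝ} {f₁ : ℂ} (hK : 0 ≤ K) (hf : 0 ≤ f₁.im)
    {x y : g.L2} (hxy : (x, y) ∈ (T1 g K f₁).graph) : (inner ℂ x y).re ≤ 0 := by
  obtain ⟨hx, rfl⟩ := mem_T1_graph_iff.1 hxy
  have hM : (inner ℂ x (mulOp g ⟨x, hx⟩)).im = 0 := by
    rw [← conj_eq_iff_im, inner_conj_symm, L2.inner_def, L2.inner_def]
    refine integral_congr_ae ?_
    filter_upwards [mulOp_coeFn g ⟨x, hx⟩] with ω h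
    rw [h, RCLike.inner_apply, RCLike.inner_apply, map_mul, conj_ofReal]
    ring
  rw [inner_add_right, inner_smul_right, inner_smul_right, inner_smul_right,
    ← inner_conj_symm x (P0 g), mul_conj, add_re, I_mul_re, hM, neg_zero, add_zero, re_mul_ofReal]
  refine mul_nonpos_of_nonpos_of_nonneg ?_ (normSq_nonneg _)
  have : (I * K * f₁).re = -(K * f₁.im) := by simp
  rw [this]
  exact neg_nonpos.2 (mul_nonneg hK hf)

lemma re_sub_I_mul (z : ℂ) (ω : ℝ) : (z - I * ω).re = z.re := by simp

lemma abs_re_le_norm_sub_I_mul (z : ℂ) (ω : ℝ) : |z.re| ≤ ‖z - I * ω‖ := by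
  rw [← re_sub_I_mul z ω]
  exact abs_re_le_norm _

lemma sub_I_mul_ne_zero {z : ℂ} (hz : z.re ≠ 0) (ω : ℝ) : z - I * ω ≠ 0 := fun h => by
  have := re_sub_I_mul z ω
  rw [h] at this
  exact hz this.symm

lemma continuous_inv_sub_I_mul {z : ℂ} (hz : z.re ≠ 0) :
    Continuous fun ω : ℝ => (z - I * ω)⁻¹ :=
  Continuous.inv₀ (by fun_prop) (sub_I_mul_ne_zero hz)

lemma norm_inv_sub_I_mul_le {z : ℂ} (hz : z.re ≠ 0) (ω : ℝ) : ‖(z - I * ω)⁻¹‖ ≤ |z.re|⁻¹ := by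
  rw [norm_inv]
  exact inv_anti₀ (abs_pos.2 hz) (abs_re_le_norm_sub_I_mul z ω)

lemma integrable_div_sub_I_mul {h : ℝ → ℂ} (hh : Integrable h) {z : ℂ} (hz : z.re ≠ 0) :
    Integrable fun ω : ℝ => h ω / (z - I * ω) := by
  simp only [div_eq_mul_inv]
  exact hh.mul_bdd (continuous_inv_sub_I_mul hz).aestronglyMeasurable
    (Eventually.of_forall (norm_inv_sub_I_mul_le hz))

lemma integrable_density (g : ProbDensity) : Integrable fun ω => (g ω : ℂ) := g.integrable.ofReal

lemma integrable_mul_density (g : ProbDensity) {q : ℝ → ℂ} (hq : MemLp q 2 g.measure) :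
    Integrable fun ω => q ω * g ω :=
  (integrable_measure_iff g q).1 (hq.integrable (by norm_num))

lemma stieltjesD_re (g : ProbDensity) {z : ℂ} (hz : z.re ≠ 0) :
    (stieltjesD g z).re = ∫ ω, g ω * (z.re / normSq (z - I * ω)) := by
  rw [stieltjesD]
  have := integral_re (integrable_div_sub_I_mul (integrable_density g) hz)
  refine (Eq.symm this).trans (integral_congr_ae (Eventually.of_forall fun ω => ?_))
  change ((g ω : ℂ) / (z - I * ω)).re = _
  rw [div_eq_mul_inv, re_ofReal_mul, inv_re, re_sub_I_mul]

/-- The real part is the integral of `g` against the strictly positive kernel `Re z / |z - iω|²`,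
and `g` has mass one. -/
lemma stieltjesD_re_pos (g : ProbDensity) {z : ℂ} (hz : 0 < z.re) : 0 < (stieltjesD g z).re := by
  rw [stieltjesD_re g hz.ne']
  have hpos : ∀ ω : ℝ, 0 < z.re / normSq (z - I * ω) := fun ω =>
    div_pos hz (normSq_pos.2 (sub_I_mul_ne_zero hz.ne' ω))
  have hinteg : Integrable fun ω => g ω * (z.re / normSq (z - I * ω)) := by
    have := (integrable_div_sub_I_mul (integrable_density g) hz.ne').re
    refine this.congr (Eventually.of_forall fun ω => ?_)
    change ((g ω : ℂ) / (z - I * ω)).re = _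
    rw [div_eq_mul_inv, re_ofReal_mul, inv_re, re_sub_I_mul]
  rw [integral_pos_iff_support_of_nonneg (fun ω => mul_nonneg (g.nonneg ω) (hpos ω).le) hinteg]
  have hsupp : Function.support (fun ω => g ω * (z.re / normSq (z - I * ω))) =
      Function.support g := by
    ext ω
    simp only [Function.mem_support, ne_eq, mul_eq_zero, (hpos ω).ne', or_false]
  rw [hsupp, ← integral_pos_iff_support_of_nonneg g.nonneg g.integrable, g.integral_eq_one]
  exact one_pos

/-- If `iKf₁D = 1`, multiplying by the conjugate of `D` and taking real parts gives `-K Im f₁ |D|² =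
Re D`, a contradiction of signs. -/
lemma one_sub_mul_ne_zero {K : ℝ} {f₁ D : ℂ} (hK : 0 ≤ K) (hf : 0 ≤ f₁.im) (hD : 0 < D.re) :
    1 - I * K * f₁ * D ≠ 0 := fun h => by
  have h1 : I * K * f₁ * D = 1 := (sub_eq_zero.1 h).symm
  have h2 : (I * K * f₁) * normSq D = starRingEnd ℂ D := by
    rw [← mul_conj, ← mul_assoc, h1, one_mul]
  have h3 := congrArg Complex.re h2
  rw [re_mul_ofReal, conj_re] at h3
  have h4 : (I * K * f₁).re = -(K * f₁.im) := by simp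
  rw [h4] at h3
  nlinarith [mul_nonneg (mul_nonneg hK hf) (normSq_nonneg D)]

lemma memLp_resolvent (g : ProbDensity) {q : ℝ → ℂ} (hq : MemLp q 2 g.measure) (a : ℂ) {z : ℂ} (hz : z.re ≠ 0) :
    MemLp (fun ω : ℝ => (q ω + a) / (z - I * ω)) 2 g.measure := by
  have h1 : MemLp (fun ω => q ω + a) 2 g.measure := hq.add (memLp_const a)
  refine h1.of_le_mul (c := |z.re|⁻¹) ?_ (Eventually.of_forall fun ω => ?_)
  · simp only [div_eq_mul_inv]
    exact h1.aestronglyMeasurable.mul (continuous_inv_sub_I_mul hz).aestronglyMeasurable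
  · rw [div_eq_mul_inv, norm_mul, mul_comm]
    exact mul_le_mul_of_nonneg_right (norm_inv_sub_I_mul_le hz ω) (norm_nonneg _)

/-- The solution of `z x - T₁ x = q`. -/
lemma resolvent_mem_graph (g : ProbDensity) {q : ℝ → ℂ} (hq : MemLp q 2 g.measure)
    {K : ℝ} {f₁ z : ℂ} (hz : z.re ≠ 0)
    (hN : 1 - I * K * f₁ * stieltjesD g z ≠ 0) :
    ∃ x : g.L2, (x, z • x - hq.toLp q) ∈ (T1 g K f₁).graph ∧
      inner ℂ (P0 g) x = freePairing g q z / (1 - I * K * f₁ * stieltjesD g z) := by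
  set c : ℂ := I * K * f₁ with hc
  -- A solution must be `x = (q + c a) / (z - iω)` with `a = (x, P₀)`. Pairing with `P₀` gives `a =
  -- Q + c a D`, whence this value.
  set a : ℂ := freePairing g q z / (1 - c * stieltjesD g z) with ha
  have hm := memLp_resolvent g hq (c * a) hz
  have hinner : inner ℂ (P0 g) (hm.toLp) = a := by
    rw [inner_P0, integral_congr_ae (MemLp.coeFn_toLp hm), integral_measure]
    have h1 : ∀ ω : ℝ, (q ω + c * a) / (z - I * ω) * g ω =
        q ω * g ω / (z - I * ω) + c * a * (g ω / (z - I * ω)) := fun ω => by ring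
    simp only [h1]
    rw [integral_add (integrable_div_sub_I_mul (integrable_mul_density g hq) hz)
      ((integrable_div_sub_I_mul (integrable_density g) hz).const_mul _), integral_const_mul]
    change freePairing g q z + c * a * stieltjesD g z = a
    rw [ha]
    field_simp
    ring
  refine ⟨hm.toLp, mem_T1_graph_iff.2 ?_, hinner⟩
  have hx : MemLp (fun ω : ℝ => (ω : ℂ) * hm.toLp _ ω) 2 g.measure := by
    refine (memLp_congr_ae ?_).2 (((hm.const_mul z).sub (hq.add (memLp_const (c * a)))).const_mul (-I))
    filter_upwards [MemLp.coeFn_toLp hm] with ω h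
    rw [h]
    have he := div_mul_cancel₀ (q ω + c * a) (sub_I_mul_ne_zero hz ω)
    simp only [Pi.sub_apply, Pi.add_apply]
    generalize (q ω + c * a) / (z - I * ω) = e at he ⊢
    rw [← he]
    linear_combination e * ω * I_sq
  refine ⟨hx, Lp.ext ?_⟩
  rw [← hc, hinner]
  filter_upwards [MemLp.coeFn_toLp hm, MemLp.coeFn_toLp hq, P0_coeFn g,
    Lp.coeFn_sub (z • hm.toLp) (hq.toLp q), Lp.coeFn_smul z hm.toLp,
    Lp.coeFn_add (c • a • P0 g) (I • mulOp g ⟨hm.toLp, hx⟩),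
    Lp.coeFn_smul c (a • P0 g), Lp.coeFn_smul a (P0 g), Lp.coeFn_smul I (mulOp g ⟨hm.toLp, hx⟩),
    mulOp_coeFn g ⟨hm.toLp, hx⟩] with ω h1 h2 h3 h4 h5 h6 h7 h8 h9 h10
  rw [h4, h6]
  simp only [Pi.add_apply, Pi.sub_apply, h5, h7, h9, Pi.smul_apply, h8, h10, h1, h2, h3, smul_eq_mul]
  have := sub_I_mul_ne_zero hz ω
  field_simp
  ring

/-- `resolventApply` chooses some solution. The difference `w` of two solutions satisfies `T₁ w = z
w`, and dissipativity gives `Re z ‖w‖² ≤ 0`. -/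
lemma resolventApply_eq (g : ProbDensity) {K : ℝ} {f₁ : ℂ} (hK : 0 ≤ K) (hf : 0 ≤ f₁.im)
    {z : ℂ} (hz : 0 < z.re) {x q : g.L2} (hx : (x, z • x - q) ∈ (T1 g K f₁).graph) :
    resolventApply (T1 g K f₁) z q = x := by
  have hex : ∃ x : (T1 g K f₁).domain, z • (x : g.L2) - T1 g K f₁ x = q := by
    obtain ⟨y, h1, h2⟩ := (LinearPMap.mem_graph_iff _).1 hx
    refine ⟨y, ?_⟩
    rw [h1, h2]
    simp
  rw [resolventApply, dif_pos hex]
  have hspec := hex.choose_spec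
  set w := hex.choose
  have h1 : ((w : g.L2), z • (w : g.L2) - q) ∈ (T1 g K f₁).graph := by
    rw [LinearPMap.mem_graph_iff]
    refine ⟨w, rfl, ?_⟩
    rw [← hspec]
    simp
  have h2 := Submodule.sub_mem _ h1 hx
  have h3 : ((w : g.L2) - x, z • ((w : g.L2) - x)) ∈ (T1 g K f₁).graph := by
    convert h2 using 1
    simp [smul_sub]
  have h4 := T1_dissipative g hK hf h3
  rw [inner_smul_right, inner_self_eq_norm_sq_to_K] at h4
  have h5 : (z * ((‖(w : g.L2) - x‖ : ℝ) : ℂ) ^ 2).re = z.re * ‖(w : g.L2) - x‖ ^ 2 := by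
    rw [← ofReal_pow, re_mul_ofReal]
  have h6 : z.re * ‖(w : g.L2) - x‖ ^ 2 ≤ 0 := h5 ▸ h4
  have h7 : ‖(w : g.L2) - x‖ ^ 2 ≤ 0 := by
    by_contra! hlt
    exact absurd h6 (not_le.2 (mul_pos hz hlt))
  have h8 : ‖(w : g.L2) - x‖ = 0 := by
    have := sq_nonneg ‖(w : g.L2) - x‖
    exact pow_eq_zero_iff (two_ne_zero) |>.1 (le_antisymm h7 this)
  exact sub_eq_zero.1 (norm_eq_zero.1 h8)

theorem F0_eq (g : ProbDensity) {K : ℝ} {f₁ : ℂ} (hK : 0 ≤ K) (hf : 0 ≤ f₁.im)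
    {q : ℝ → ℂ} (hq : MemLp q 2 g.measure) {z : ℂ} (hz : 0 < z.re) :
    F0 g K f₁ (hq.toLp q) z = freePairing g q z / (1 - I * K * f₁ * stieltjesD g z) := by
  obtain ⟨x, hx, hxi⟩ := resolvent_mem_graph g hq (K := K) (f₁ := f₁) hz.ne'
    (one_sub_mul_ne_zero hK hf (stieltjesD_re_pos g hz))
  rw [F0, resolventApply_eq g hK hf hz hx, hxi]

theorem norm_semigroup_apply_le (g : ProbDensity) {K : ℝ} {f₁ : ℂ} (hK : 0 ≤ K) (hf : 0 ≤ f₁.im)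
    {S : C0Semigroup g.L2} (hS : S.IsGeneratedBy (T1 g K f₁)) {t : ℝ} (ht : 0 ≤ t) (x : g.L2) :
    ‖S.toFun t x‖ ≤ ‖x‖ :=
  C0Semigroup.norm_apply_le hS (fun _ _ h => T1_dissipative g hK hf h) (mulOp_domain_dense g) ht x

/-- `F₀` is the Laplace transform of the order parameter. -/
theorem laplace_eq_F0 (g : ProbDensity) {K : ℝ} {f₁ : ℂ} (hK : 0 ≤ K) (hf : 0 ≤ f₁.im)
    {S : C0Semigroup g.L2} (hS : S.IsGeneratedBy (T1 g K f₁))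
    {q : ℝ → ℂ} (hq : MemLp q 2 g.measure) {z : ℂ} (hz : 0 < z.re) :
    ∫ t in Set.Ioi (0 : ℝ), cexp (-(z * t)) * inner ℂ (P0 g) (S.toFun t (hq.toLp q)) =
      F0 g K f₁ (hq.toLp q) z := by
  obtain ⟨x, hx, hxi⟩ := resolvent_mem_graph g hq (K := K) (f₁ := f₁) hz.ne'
    (one_sub_mul_ne_zero hK hf (stieltjesD_re_pos g hz))
  rw [F0_eq g hK hf hq hz, ← hxi]
  have := C0Semigroup.laplace_eq hS (fun t ht x => norm_semigroup_apply_le g hK hf hS ht x)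
    (innerSL ℂ (P0 g)) hz hx
  simpa using this

/-! ### Cauchy integrals and their continuation across the imaginary axis -/

/-- A dominated integral of holomorphic functions is holomorphic, and may be differentiated under
the integral sign. -/
lemma hasDerivAt_integral_of_dominated {α : Type*} [MeasurableSpace α] {μ : Measure α}
    {F : ℂ → α → ℂ} {U : Set ℂ} (hU : IsOpen U) {bound : α → ℝ}
    (hmeas : ∀ w ∈ U, AEStronglyMeasurable (F w) μ)
    (hdiff : ∀ᵐ a ∂μ, DifferentiableOn ℂ (F · a) U)
    (hb : ∀ᵐ a ∂μ, ∀ w ∈ U, ‖F w a‖ ≤ bound a) (hbi : Integrable bound μ) {w : ℂ} (hw : w ∈ U) :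
    HasDerivAt (fun w => ∫ a, F w a ∂μ) (∫ a, deriv (F · a) w ∂μ) w := by
  obtain ⟨r, hr, hrU⟩ := Metric.isOpen_iff.1 hU w hw
  have hr3 : 0 < r / 3 := by positivity
  have hsub : ∀ x ∈ Metric.ball w (r / 3), Metric.closedBall x (r / 3) ⊆ U := fun x hx y hy => by
    refine hrU (Metric.mem_ball.2 ?_)
    have h1 := Metric.mem_ball.1 hx
    have h2 := Metric.mem_closedBall.1 hy
    linarith [dist_triangle y x w]
  have hUn : U ∈ 𝓝 w := hU.mem_nhds hw
  -- The Cauchy estimate on discs of radius `r / 3` supplies the dominating function for the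
  -- derivative. Its measurability comes from difference quotients along the sequence `u`.
  refine (hasDerivAt_integral_of_dominated_loc_of_deriv_le (F := F)
    (F' := fun w a => deriv (F · a) w) (bound := fun a => bound a / (r / 3))
    (Metric.ball_mem_nhds w hr3) ?_ ?_ ?_ ?_ (hbi.div_const _) ?_).2
  · filter_upwards [hUn] with x hx using hmeas x hx
  · exact hbi.mono' (hmeas w hw) (hb.mono fun a ha => ha w hw)
  · set u : ℕ → ℂ := fun n => ((r / 3 * (1 / ((n : ℝ) + 1)) : ℝ) : ℂ)
    have hu0 : ∀ n, u n ≠ 0 := fun n => by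
      have : 0 < r / 3 * (1 / ((n : ℝ) + 1)) := by positivity
      exact ofReal_ne_zero.2 this.ne'
    have hut : Tendsto u atTop (𝓝 0) := by
      have := (tendsto_one_div_add_atTop_nhds_zero_nat (𝕜 := ℝ)).const_mul (r / 3)
      rw [mul_zero] at this
      simpa only [ofReal_zero] using! (continuous_ofReal.tendsto (0 : ℝ)).comp this
    have huU : ∀ n, w + u n ∈ U := fun n => by
      refine hsub w (Metric.mem_ball_self hr3) ?_
      rw [Metric.mem_closedBall, dist_self_add_left, norm_real, Real.norm_eq_abs,
        abs_of_nonneg (by positivity)]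
      have : 1 / ((n : ℝ) + 1) ≤ 1 := by
        rw [div_le_one (by positivity)]; linarith [Nat.cast_nonneg (α := ℝ) n]
      nlinarith
    refine aestronglyMeasurable_of_tendsto_ae atTop
      (f := fun n a => (u n)⁻¹ • (F (w + u n) a - F w a)) (fun n => ?_) ?_
    · exact ((hmeas _ (huU n)).sub (hmeas w hw)).const_smul (u n)⁻¹
    · filter_upwards [hdiff] with a ha
      have h1 := (ha.differentiableAt hUn).hasDerivAt
      rw [hasDerivAt_iff_tendsto_slope_zero] at h1
      exact h1.comp (tendsto_nhdsWithin_iff.2 ⟨hut, Eventually.of_forall hu0⟩)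
  · filter_upwards [hdiff, hb] with a ha hba x hx
    refine norm_deriv_le_of_forall_mem_sphere_norm_le hr3 ?_ fun y hy =>
      hba y (hsub x hx (Metric.sphere_subset_closedBall hy))
    exact DifferentiableOn.diffContOnCl
      (ha.mono ((closure_mono Metric.ball_subset_closedBall).trans
        (by rw [Metric.isClosed_closedBall.closure_eq]; exact hsub x hx)))
  · filter_upwards [hdiff] with a ha x hx
    exact (ha.differentiableAt
      (hU.mem_nhds (hsub x hx (Metric.mem_closedBall_self hr3.le)))).hasDerivAt

lemma log_neg_of_im_pos {v : ℂ} (hv : 0 < v.im) : log (-v) = log v - Real.pi * I := by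
  apply Complex.ext <;> simp [log_re, log_im, arg_neg_eq_arg_sub_pi_of_im_pos hv]

lemma log_neg_of_im_neg {v : ℂ} (hv : v.im < 0) : log (-v) = log v + Real.pi * I := by
  apply Complex.ext <;> simp [log_re, log_im, arg_neg_eq_arg_add_pi_of_im_neg hv]

lemma sub_I_mul_im (z : ℂ) (ω : ℝ) : (z - I * ω).im = z.im - ω := by simp

lemma integral_inv_sub_I_mul_of_re_pos {z : ℂ} (hz : 0 < z.re) (a b : ℝ) :
    ∫ ω in a..b, (z - I * ω)⁻¹ = I * (log (z - I * b) - log (z - I * a)) := by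
  have hne : ∀ ω : ℝ, z - I * ω ∈ slitPlane := fun ω => Or.inl (by rw [re_sub_I_mul]; exact hz)
  have hd : ∀ ω : ℝ, HasDerivAt (fun ω : ℝ => I * log (z - I * ω)) (z - I * ω)⁻¹ ω := fun ω => by
    have h1 : HasDerivAt (fun ω : ℝ => z - I * (ω : ℂ)) (-I) ω := by
      simpa using (((hasDerivAt_id (ω : ℂ)).const_mul I).const_sub z).comp_ofReal
    refine ((h1.clog_real (hne ω)).const_mul I).congr_deriv ?_
    rw [mul_div_assoc', mul_neg, I_mul_I, neg_neg, one_div]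
  rw [intervalIntegral.integral_eq_sub_of_hasDerivAt (fun ω _ => hd ω), mul_sub]
  exact (Continuous.inv₀ (by fun_prop)
    fun ω => slitPlane_ne_zero (hne ω)).intervalIntegrable _ _

/-- Now `z - iω` crosses the branch cut of `log` at `ω = Im z`. Reflecting `z` and `ω` returns to
the right half plane. The two endpoint corrections `±πi` then add up to `-2π`, the source of the
jump. -/
lemma integral_inv_sub_I_mul_of_re_neg {z : ℂ} (hz : z.re < 0) {a b : ℝ} (ha : a < z.im)
    (hb : z.im < b) :
    ∫ ω in a..b, (z - I * ω)⁻¹ = I * (log (z - I * b) - log (z - I * a)) - 2 * Real.pi := by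
  have h1 := integral_inv_sub_I_mul_of_re_pos (z := -z) (by simpa using hz) (-b) (-a)
  have h2 : ∫ ω in a..b, (z - I * ω)⁻¹ = - ∫ ω in (-b)..(-a), (-z - I * ω)⁻¹ := by
    rw [← intervalIntegral.integral_neg, ← intervalIntegral.integral_comp_neg]
    refine intervalIntegral.integral_congr fun ω _ => ?_
    simp only [ofReal_neg, ← inv_neg]
    ring_nf
  have h3 : -z - I * ((-a : ℝ) : ℂ) = -(z - I * a) := by push_cast; ring
  have h4 : -z - I * ((-b : ℝ) : ℂ) = -(z - I * b) := by push_cast; ring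
  rw [h2, h1, h3, h4, log_neg_of_im_pos (by rw [sub_I_mul_im]; linarith),
    log_neg_of_im_neg (by rw [sub_I_mul_im]; linarith)]
  linear_combination (2 * (Real.pi : ℂ)) * I_sq


lemma differentiableAt_cauchy_integral {h : ℝ → ℂ} (hh : Integrable h) {s : Set ℝ}
    (hs : MeasurableSet s) {z₀ : ℂ} {r : ℝ} (hr : 0 < r)
    (hsep : ∀ ω ∈ s, 2 * r ≤ ‖z₀ - I * ω‖) {z : ℂ} (hz : z ∈ Metric.ball z₀ r) :
    DifferentiableAt ℂ (fun z => ∫ ω in s, h ω / (z - I * ω)) z := by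
  have hfar : ∀ ω ∈ s, ∀ z ∈ Metric.ball z₀ r, r ≤ ‖z - I * ω‖ := fun ω hω z hz => by
    have h1 := hsep ω hω
    have h2 : ‖z₀ - I * ω‖ ≤ ‖z - I * ω‖ + ‖z - z₀‖ := by
      rw [show z₀ - I * ω = (z - I * ω) - (z - z₀) by ring]
      exact norm_sub_le _ _
    have h3 := mem_ball_iff_norm.1 hz
    linarith
  refine (hasDerivAt_integral_of_dominated (U := Metric.ball z₀ r)
    (F := fun z (ω : ℝ) => h ω / (z - I * ω)) Metric.isOpen_ball (bound := fun ω => ‖h ω‖ / r)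
    (fun w hw => ?_) ?_ ?_ ((hh.norm.div_const r).restrict) hz).differentiableAt
  · exact hh.aestronglyMeasurable.restrict.div₀ (by fun_prop)
  · filter_upwards [ae_restrict_mem hs] with ω hω
    intro w hw
    have : w - I * ω ≠ 0 := norm_pos_iff.1 (hr.trans_le (hfar ω hω w hw))
    have h1 : DifferentiableAt ℂ (fun w : ℂ => w - I * ω) w := by fun_prop
    exact ((differentiableAt_const (h ω)).div h1 this).differentiableWithinAt
  · filter_upwards [ae_restrict_mem hs] with ω hω w hw
    rw [norm_div]
    exact div_le_div_of_nonneg_left (norm_nonneg _) hr (hfar ω hω w hw)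

lemma differentiableAt_cauchy_integral_of_re_ne_zero {h : ℝ → ℂ} (hh : Integrable h) {z : ℂ}
    (hz : z.re ≠ 0) : DifferentiableAt ℂ (fun z => ∫ ω : ℝ, h ω / (z - I * ω)) z := by
  have hr : 0 < |z.re| / 2 := by positivity
  have := differentiableAt_cauchy_integral hh MeasurableSet.univ (z₀ := z) hr
    (fun ω _ => by linarith [abs_re_le_norm_sub_I_mul z ω]) (Metric.mem_ball_self hr)
  simpa using this

lemma norm_dslope_le {f : ℂ → ℂ} {s : Set ℂ} (hs : Convex ℝ s) {M : ℝ}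
    (hf : ∀ x ∈ s, DifferentiableAt ℂ f x) (hM : ∀ x ∈ s, ‖deriv f x‖ ≤ M) {a b : ℂ}
    (ha : a ∈ s) (hb : b ∈ s) : ‖dslope f a b‖ ≤ M := by
  rcases eq_or_ne b a with rfl | hne
  · rw [dslope_same]
    exact hM b hb
  · rw [dslope_of_ne _ hne, slope_def_field, norm_div, div_le_iff₀ (norm_pos_iff.2 (sub_ne_zero.2 hne))]
    exact hs.norm_image_sub_le_of_norm_deriv_le hf hM ha hb

lemma ne_ofReal_ae (w : ℂ) : ∀ᵐ ω : ℝ, w ≠ ω := by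
  have : ∀ᵐ ω : ℝ, ω ≠ w.re := by
    simp [ae_iff]
  filter_upwards [this] with ω hω h
  exact hω (by rw [h, ofReal_re])

lemma aestronglyMeasurable_dslope {f : ℂ → ℂ} {a b : ℝ}
    (hf : ∀ ω ∈ Set.Ioc a b, ContinuousAt f (ω : ℂ)) {w : ℂ} :
    AEStronglyMeasurable (fun ω : ℝ => dslope f ω w) (volume.restrict (Set.Ioc a b)) := by
  have hc : ContinuousOn (fun ω : ℝ => f ω) (Set.Ioc a b) := fun ω hω =>
    (ContinuousAt.comp (f := fun ω : ℝ => (ω : ℂ)) (hf ω hω)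
      continuous_ofReal.continuousAt).continuousWithinAt
  have h1 : AEStronglyMeasurable (fun ω : ℝ => (f w - f ω) / (w - ω))
      (volume.restrict (Set.Ioc a b)) :=
    (aestronglyMeasurable_const.sub (hc.aestronglyMeasurable measurableSet_Ioc)).div₀ (by fun_prop)
  refine h1.congr ?_
  filter_upwards [ae_restrict_of_ae (ne_ofReal_ae w)] with ω hω
  rw [dslope_of_ne _ hω, slope_def_field]

lemma intervalIntegral_dslope_differentiableAt {f : ℂ → ℂ} {y r M : ℝ}
    (hf : ∀ x ∈ Metric.ball (y : ℂ) r, DifferentiableAt ℂ f x)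
    (hM : ∀ x ∈ Metric.ball (y : ℂ) r, ‖deriv f x‖ ≤ M) {a b : ℝ}
    (hJ : ∀ ω ∈ Set.Ioc a b, (ω : ℂ) ∈ Metric.ball (y : ℂ) r)
    {w : ℂ} (hw : w ∈ Metric.ball (y : ℂ) r) :
    DifferentiableAt ℂ (fun w => ∫ ω : ℝ in Set.Ioc a b, dslope f ω w) w := by
  have hfd : DifferentiableOn ℂ f (Metric.ball (y : ℂ) r) := fun x hx =>
    (hf x hx).differentiableWithinAt
  refine (hasDerivAt_integral_of_dominated (U := Metric.ball (y : ℂ) r)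
    (F := fun w (ω : ℝ) => dslope f ω w) Metric.isOpen_ball (bound := fun _ => M)
    (fun w hw => ?_) ?_ ?_ (integrable_const M) hw).differentiableAt
  · exact aestronglyMeasurable_dslope fun ω hω => (hf _ (hJ ω hω)).continuousAt
  · filter_upwards [ae_restrict_mem measurableSet_Ioc] with ω hω
    exact (Complex.differentiableOn_dslope (Metric.isOpen_ball.mem_nhds (hJ ω hω))).2 hfd
  · filter_upwards [ae_restrict_mem measurableSet_Ioc] with ω hω w hw
    exact norm_dslope_le (convex_ball _ _) hf hM (hJ ω hω) hw

/-- **Analytic continuation of a Cauchy integral across the line.** -/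
theorem exists_analytic_continuation_cauchy {h : ℝ → ℂ} (hh : Integrable h) {hs : ℂ → ℂ}
    (heq : ∀ x : ℝ, hs x = h x) {y : ℝ} (hy : AnalyticAt ℂ hs y) :
    ∃ Φ : ℂ → ℂ, AnalyticAt ℂ Φ (I * y) ∧ ∀ᶠ z in 𝓝 (I * (y : ℂ)),
      (0 < z.re → Φ z = ∫ ω : ℝ, h ω / (z - I * ω)) ∧
      (z.re < 0 → Φ z = (∫ ω : ℝ, h ω / (z - I * ω)) + 2 * Real.pi * hs (-I * z)) := by
  set M : ℝ := ‖deriv hs y‖ + 1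
  obtain ⟨r, hr, hball⟩ : ∃ r > 0, ∀ x ∈ Metric.ball (y : ℂ) r,
      AnalyticAt ℂ hs x ∧ ‖deriv hs x‖ ≤ M := by
    have h1 : ∀ᶠ x in 𝓝 (y : ℂ), ‖deriv hs x‖ < M :=
      (hy.deriv.continuousAt.norm).eventually_lt continuousAt_const (lt_add_one _)
    obtain ⟨r, hr, h⟩ := Metric.eventually_nhds_iff_ball.1 (hy.eventually_analyticAt.and h1)
    exact ⟨r, hr, fun x hx => ⟨(h x hx).1, (h x hx).2.le⟩⟩
  set ρ : ℝ := r / 2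
  have hρ : 0 < ρ := by positivity
  set a : ℝ := y - ρ
  set b : ℝ := y + ρ
  have hab : a ≤ b := by simp only [a, b]; linarith
  have hJ : ∀ ω ∈ Set.Ioc a b, (ω : ℂ) ∈ Metric.ball (y : ℂ) r := fun ω hω => by
    rw [mem_ball_iff_norm, ← ofReal_sub, norm_real, Real.norm_eq_abs, abs_lt]
    simp only [Set.mem_Ioc, a, b, ρ] at hω
    constructor <;> linarith [hω.1, hω.2]
  have hsep : ∀ ω ∈ (Set.Ioc a b)ᶜ, 2 * (ρ / 2) ≤ ‖I * y - I * ω‖ := fun ω hω => by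
    rw [← mul_sub, norm_mul, norm_I, one_mul, ← ofReal_sub, norm_real, Real.norm_eq_abs]
    by_contra! hlt
    rw [abs_lt] at hlt
    refine hω ⟨?_, ?_⟩ <;> simp only [a, b] <;> linarith [hlt.1, hlt.2]
  have hw_ball : ∀ z ∈ Metric.ball (I * (y : ℂ)) (ρ / 2), -I * z ∈ Metric.ball (y : ℂ) r :=
    fun z hz => by
    rw [mem_ball_iff_norm] at hz ⊢
    have : -I * z - y = -I * (z - I * y) := by
      linear_combination (-y : ℂ) * I_sq
    rw [this, norm_mul, norm_neg, norm_I, one_mul]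
    simp only [ρ] at hz
    linarith
  have him : ∀ z ∈ Metric.ball (I * (y : ℂ)) (ρ / 2), a < z.im ∧ z.im < b := fun z hz => by
    have h1 := (abs_im_le_norm (z - I * y)).trans_lt (mem_ball_iff_norm.1 hz)
    simp only [sub_im, mul_im, I_re, ofReal_im, mul_zero, I_im, ofReal_re, one_mul, zero_add,
      abs_lt] at h1
    simp only [a, b]
    constructor <;> linarith [h1.1, h1.2]
  -- With `w = -iz`, split the near part by `h(ω) = hs(w) + (h(ω) - hs(w))`. The far integral and
  -- the integral of the difference quotient are holomorphic near `iy`. What remains is `hs(w)`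
  -- times an explicit logarithm, holomorphic there because `a < Im z < b`.
  refine ⟨fun z => (∫ ω in (Set.Ioc a b)ᶜ, h ω / (z - I * ω)) +
    I * (∫ ω : ℝ in Set.Ioc a b, dslope hs ω (-I * z)) +
    hs (-I * z) * (I * (log (z - I * b) - log (z - I * a))), ?_, ?_⟩
  · refine (DifferentiableOn.analyticAt (s := Metric.ball (I * (y : ℂ)) (ρ / 2)) (fun z hz => ?_)
      (Metric.ball_mem_nhds _ (by positivity)))
    refine DifferentiableAt.differentiableWithinAt ?_
    have hlin : DifferentiableAt ℂ (fun z : ℂ => -I * z) z := by fun_prop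
    refine ((differentiableAt_cauchy_integral hh measurableSet_Ioc.compl (by positivity) hsep
      hz).add (DifferentiableAt.const_mul ?_ _)).add (DifferentiableAt.mul ?_
      (DifferentiableAt.const_mul (DifferentiableAt.sub ?_ ?_) _))
    · exact (intervalIntegral_dslope_differentiableAt (fun x hx => (hball x hx).1.differentiableAt)
        (fun x hx => (hball x hx).2) hJ (hw_ball z hz)).comp z hlin
    · exact (hball _ (hw_ball z hz)).1.differentiableAt.comp z hlin
    · refine DifferentiableAt.clog (by fun_prop) (Or.inr ?_)
      rw [sub_I_mul_im]
      linarith [him z hz]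
    · refine DifferentiableAt.clog (by fun_prop) (Or.inr ?_)
      rw [sub_I_mul_im]
      linarith [him z hz]
  · filter_upwards [Metric.ball_mem_nhds (I * (y : ℂ)) (by positivity : 0 < ρ / 2)] with z hz
    have hsplit : z.re ≠ 0 → ∫ ω : ℝ, h ω / (z - I * ω) =
        (∫ ω in (Set.Ioc a b)ᶜ, h ω / (z - I * ω)) +
        I * (∫ ω : ℝ in Set.Ioc a b, dslope hs ω (-I * z)) +
        hs (-I * z) * ∫ ω in a..b, (z - I * ω)⁻¹ := fun hz0 => by
      have hi := integrable_div_sub_I_mul hh hz0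
      rw [← integral_add_compl measurableSet_Ioc hi, intervalIntegral.integral_of_le hab,
        ← integral_const_mul, ← integral_const_mul, add_comm (∫ ω in Set.Ioc a b, _), add_assoc,
        ← integral_add]
      · congr 1
        refine setIntegral_congr_fun measurableSet_Ioc fun ω hω => ?_
        have hne : -I * z ≠ ω := fun he => by
          have := congrArg Complex.im he
          simp at this
          exact hz0 this
        have hne' := sub_I_mul_ne_zero hz0 ω
        simp only [dslope_of_ne _ hne, slope_def_field, heq]
        have h2 : -I * z - ω = -I * (z - I * ω) := by linear_combination (-ω : ℂ) * I_sq
        rw [h2]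
        field_simp
        ring
      · refine Integrable.const_mul ?_ I
        refine (integrable_const M).mono' (aestronglyMeasurable_dslope
          fun ω hω => (hball _ (hJ ω hω)).1.continuousAt) ?_
        filter_upwards [ae_restrict_mem measurableSet_Ioc] with ω hω
        exact norm_dslope_le (convex_ball (y : ℂ) r) (fun x hx => (hball x hx).1.differentiableAt)
          (fun x hx => (hball x hx).2) (hJ ω hω) (hw_ball z hz)
      · exact ((continuous_inv_sub_I_mul hz0).const_mul _).integrableOn_Ioc
    refine ⟨fun hz0 => ?_, fun hz0 => ?_⟩
    · rw [hsplit hz0.ne', integral_inv_sub_I_mul_of_re_pos hz0]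
    · rw [hsplit hz0.ne, integral_inv_sub_I_mul_of_re_neg hz0 (him z hz).1 (him z hz).2]
      ring

/-! ### Boundary values and the denominator on the imaginary axis -/

lemma tendsto_I_mul_add (y : ℝ) : Tendsto (fun ε : ℝ => I * (y : ℂ) + ε) (𝓝[>] 0) (𝓝 (I * y)) := by
  have : Continuous fun ε : ℝ => I * (y : ℂ) + ε := by fun_prop
  simpa using tendsto_nhdsWithin_of_tendsto_nhds (s := Set.Ioi 0) (this.tendsto 0)

lemma tendsto_I_mul_sub (y : ℝ) : Tendsto (fun ε : ℝ => I * (y : ℂ) - ε) (𝓝[>] 0) (𝓝 (I * y)) := by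
  have : Continuous fun ε : ℝ => I * (y : ℂ) - ε := by fun_prop
  simpa using tendsto_nhdsWithin_of_tendsto_nhds (s := Set.Ioi 0) (this.tendsto 0)

/-- The real part of the boundary value of `D` is `π g`. -/
lemma boundary_value_re (g : ProbDensity) {gs Φ : ℂ → ℂ} {y : ℝ} (hgs : ContinuousAt gs y)
    (hgy : gs y = g y) (hΦ : ContinuousAt Φ (I * y))
    (hev : ∀ᶠ z in 𝓝 (I * (y : ℂ)), (0 < z.re → Φ z = stieltjesD g z) ∧
      (z.re < 0 → Φ z = stieltjesD g z + 2 * Real.pi * gs (-I * z))) :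
    (Φ (I * y)).re = Real.pi * g y := by
  have hp := tendsto_I_mul_add y
  have hm := tendsto_I_mul_sub y
  -- The real parts of `D` at `iy + ε` and `iy - ε` are opposite, so in the sum only the jump term
  -- `2πg` survives.
  have h1 : Tendsto (fun ε : ℝ => (Φ (I * y + ε) + Φ (I * y - ε)).re) (𝓝[>] 0)
      (𝓝 (Φ (I * y) + Φ (I * y)).re) :=
    (continuous_re.tendsto _).comp ((hΦ.tendsto.comp hp).add (hΦ.tendsto.comp hm))
  have hval : -I * (I * (y : ℂ)) = y := by linear_combination (-y : ℂ) * I_sq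
  have h2 : Tendsto (fun ε : ℝ => (2 * Real.pi * gs (-I * (I * y - ε))).re) (𝓝[>] 0)
      (𝓝 (2 * Real.pi * gs y).re) := by
    refine (continuous_re.tendsto _).comp (Tendsto.const_mul _ (hgs.tendsto.comp ?_))
    have := hm.const_mul (-I)
    rwa [hval] at this
  have h3 : (Φ (I * y) + Φ (I * y)).re = (2 * Real.pi * gs y).re := by
    refine tendsto_nhds_unique (h1.congr' ?_) h2
    filter_upwards [hp.eventually hev, hm.eventually hev, self_mem_nhdsWithin]
      with ε e1 e2 (hε : 0 < ε)
    have r1 : (I * (y : ℂ) + ε).re = ε := by simp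
    have r2 : (I * (y : ℂ) - ε).re = -ε := by simp
    rw [e1.1 (by rw [r1]; exact hε), e2.2 (by rw [r2]; linarith), ← add_assoc, add_re, add_re,
      stieltjesD_re g (by rw [r1]; exact hε.ne'), stieltjesD_re g (by rw [r2]; linarith), r1, r2]
    have : ∀ ω : ℝ, normSq (I * (y : ℂ) - ε - I * ω) = normSq (I * (y : ℂ) + ε - I * ω) := fun ω => by
      simp [normSq_apply]
    simp only [this, neg_div, mul_neg, integral_neg, add_neg_cancel, zero_add]
  rw [hgy, add_re, ← ofReal_ofNat, ← ofReal_mul, ← ofReal_mul, ofReal_re] at h3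
  linarith

/-- At a zero of `g` one has `g(ω) = O(|ω - y|)`. Hence `g(ω) / (y - ω)` is integrable without a
principal value, and dominated convergence applies as `ε → 0+`. -/
lemma boundary_value_of_zero (g : ProbDensity) {Φ : ℂ → ℂ} {y : ℝ}
    (hg : DifferentiableAt ℝ g y) (hgy : g y = 0) (hΦ : ContinuousAt Φ (I * y))
    (hev : ∀ᶠ z in 𝓝 (I * (y : ℂ)), 0 < z.re → Φ z = stieltjesD g z) :
    Φ (I * y) = -I * ((∫ ω : ℝ, g ω / (y - ω) : ℝ) : ℂ) := by
  have hp := tendsto_I_mul_add y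
  obtain ⟨C, hC⟩ := (hg.isBigO_sub).bound
  obtain ⟨r, hr, hball⟩ := Metric.eventually_nhds_iff_ball.1 hC
  have hlim : Tendsto (fun ε : ℝ => stieltjesD g (I * y + ε)) (𝓝[>] 0)
      (𝓝 (∫ ω : ℝ, (g ω : ℂ) / (I * y - I * ω))) := by
    refine tendsto_integral_filter_of_dominated_convergence
      (fun ω => (Metric.ball y r).indicator (fun _ => |C|) ω + g ω / r)
      (Eventually.of_forall fun ε => ?_) (Eventually.of_forall fun ε => ?_) ?_ ?_
    · exact (integrable_density g).aestronglyMeasurable.div₀ (by fun_prop)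
    · have hne : ∀ᵐ ω : ℝ, ω ≠ y := by simp [ae_iff]
      filter_upwards [hne] with ω hω
      have h1 : |y - ω| ≤ ‖I * y + ε - I * ω‖ := by
        have := abs_im_le_norm (I * y + ε - I * ω)
        simpa using this
      have hpos : 0 < |y - ω| := abs_pos.2 (sub_ne_zero.2 hω.symm)
      rw [norm_div, norm_real, Real.norm_eq_abs, abs_of_nonneg (g.nonneg ω)]
      refine (div_le_div_of_nonneg_left (g.nonneg ω) hpos h1).trans ?_
      by_cases hωb : ω ∈ Metric.ball y r
      · rw [Set.indicator_of_mem hωb]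
        have h2 := hball ω hωb
        rw [hgy, sub_zero, Real.norm_eq_abs, Real.norm_eq_abs, abs_of_nonneg (g.nonneg ω),
          abs_sub_comm] at h2
        have h3 : g ω / |y - ω| ≤ |C| := by
          rw [div_le_iff₀ hpos]
          exact h2.trans (mul_le_mul_of_nonneg_right (le_abs_self C) hpos.le)
        exact h3.trans (le_add_of_nonneg_right (div_nonneg (g.nonneg ω) hr.le))
      · rw [Set.indicator_of_notMem hωb, zero_add]
        rw [Metric.mem_ball, not_lt, Real.dist_eq, abs_sub_comm] at hωb
        exact div_le_div_of_nonneg_left (g.nonneg ω) hr hωb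
    · exact ((integrable_indicator_iff Metric.isOpen_ball.measurableSet).2
        (integrableOn_const measure_ball_lt_top.ne)).add (g.integrable.div_const r)
    · have hne : ∀ᵐ ω : ℝ, ω ≠ y := by simp [ae_iff]
      filter_upwards [hne] with ω hω
      refine Tendsto.div tendsto_const_nhds (hp.sub_const _) ?_
      rw [← mul_sub]
      refine mul_ne_zero I_ne_zero (sub_ne_zero.2 ?_)
      exact_mod_cast hω.symm
  have h2 : Φ (I * y) = ∫ ω : ℝ, (g ω : ℂ) / (I * y - I * ω) := by
    refine tendsto_nhds_unique (hΦ.tendsto.comp hp) (hlim.congr' ?_)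
    filter_upwards [hp.eventually hev, self_mem_nhdsWithin] with ε e1 (hε : 0 < ε)
    exact (e1 (by simpa using hε)).symm
  rw [h2, ← integral_complex_ofReal, ← integral_const_mul]
  refine integral_congr_ae (Eventually.of_forall fun ω => ?_)
  simp only [ofReal_div, ofReal_sub]
  rw [← mul_sub, div_mul_eq_div_div_swap, div_I]
  ring

/-- `T₁` has no eigenvalue on the imaginary axis: the boundary value of `1 - iKf₁D` does not vanish. -/
lemma boundary_denominator_ne_zero (g : ProbDensity) {gs Φ : ℂ → ℂ} {y K : ℝ} {f₁ : ℂ}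
    (hK : 0 < K) (hf : 0 ≤ f₁.im)
    (hres : f₁.im = 0 → g y = 0 → K * f₁.re * ∫ ω : ℝ, g ω / (y - ω) ≠ 1)
    (hg : DifferentiableAt ℝ g y) (hgs : ContinuousAt gs y)
    (hgy : gs y = g y) (hΦ : ContinuousAt Φ (I * y))
    (hev : ∀ᶠ z in 𝓝 (I * (y : ℂ)), (0 < z.re → Φ z = stieltjesD g z) ∧
      (z.re < 0 → Φ z = stieltjesD g z + 2 * Real.pi * gs (-I * z))) :
    1 - I * K * f₁ * Φ (I * y) ≠ 0 := fun h => by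
  have hre := boundary_value_re g hgs hgy hΦ hev
  have h1 : I * K * f₁ * Φ (I * y) = 1 := (sub_eq_zero.1 h).symm
  have h2 : (I * K * f₁) * normSq (Φ (I * y)) = starRingEnd ℂ (Φ (I * y)) := by
    rw [← mul_conj, ← mul_assoc, h1, one_mul]
  have h3 := congrArg Complex.re h2
  have h4 : (I * K * f₁).re = -(K * f₁.im) := by simp
  -- This reads `-K Im f₁ |Φ|² = π g(y)`. The left side is nonpositive and the right side
  -- nonnegative, so `Im f₁ = 0` and `g(y) = 0`.
  rw [re_mul_ofReal, conj_re, hre, h4] at h3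
  have hΦ0 : Φ (I * y) ≠ 0 := fun h0 => by simp [h0] at h1
  have hn := normSq_pos.2 hΦ0
  have hg0 : 0 ≤ Real.pi * g y := mul_nonneg Real.pi_pos.le (g.nonneg y)
  have hfi : f₁.im = 0 := by
    by_contra hne
    have : 0 < f₁.im := lt_of_le_of_ne hf (Ne.symm hne)
    have := mul_pos (mul_pos hK this) hn
    linarith
  have hgy0 : g y = 0 := by
    rw [hfi] at h3
    have : Real.pi * g y = 0 := by linarith
    exact (mul_eq_zero.1 this).resolve_left Real.pi_ne_zero
  refine hres hfi hgy0 ?_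
  rw [boundary_value_of_zero g hg hgy0 hΦ (hev.mono fun _ h => h.1)] at h1
  have hf1 : f₁ = (f₁.re : ℂ) := Complex.ext rfl (by simpa using hfi)
  rw [hf1] at h1
  have h5 : ((K * f₁.re * ∫ ω : ℝ, g ω / (y - ω) : ℝ) : ℂ) = 1 := by
    rw [← h1]
    push_cast
    linear_combination (K * f₁.re * ((∫ ω : ℝ, g ω / (y - ω) : ℝ) : ℂ)) * I_sq
  exact_mod_cast h5


/-! ### The meromorphic function `F₁` -/

section Continuation

variable (g : ProbDensity) {K : ℝ} {f₁ : ℂ} {q : ℝ → ℂ} (hq : MemLp q 2 g.measure) (gs qs : ℂ → ℂ)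

lemma F1pre_of_re_pos {z : ℂ} (hz : 0 < z.re) :
    F1pre g K f₁ q hq gs qs z = F0 g K f₁ (hq.toLp q) z := if_pos hz

lemma F1pre_of_re_neg {z : ℂ} (hz : z.re < 0) : F1pre g K f₁ q hq gs qs z =
    (freePairing g q z + 2 * Real.pi * qs (-I * z) * gs (-I * z)) /
      (1 - I * K * f₁ * stieltjesD g z - 2 * Real.pi * I * K * f₁ * gs (-I * z)) := by
  rw [F1pre, if_neg hz.not_gt, if_pos hz]

lemma F1pre_of_re_eq_zero {z : ℂ} (hz : z.re = 0) : F1pre g K f₁ q hq gs qs z =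
    limUnder (𝓝[{w : ℂ | 0 < w.re}] z) (F0 g K f₁ (hq.toLp q)) := by
  rw [F1pre, if_neg hz.not_gt, if_neg hz.not_lt]

variable {gs qs}

lemma analyticAt_F1pre_of_re_pos (hK : 0 < K) (hf : 0 ≤ f₁.im) {z : ℂ} (hz : 0 < z.re) :
    AnalyticAt ℂ (F1pre g K f₁ q hq gs qs) z := by
  have hopen : IsOpen {w : ℂ | 0 < w.re} := isOpen_lt continuous_const continuous_re
  refine DifferentiableOn.analyticAt (s := {w : ℂ | 0 < w.re}) ?_ (hopen.mem_nhds hz)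
  have h1 : DifferentiableOn ℂ (fun w => freePairing g q w / (1 - I * K * f₁ * stieltjesD g w))
      {w : ℂ | 0 < w.re} := fun w (hw : 0 < w.re) =>
    DifferentiableAt.differentiableWithinAt <|
      (differentiableAt_cauchy_integral_of_re_ne_zero (integrable_mul_density g hq) hw.ne').div
        (((differentiableAt_cauchy_integral_of_re_ne_zero (integrable_density g) hw.ne').const_mul
          (I * K * f₁)).const_sub 1)
        (one_sub_mul_ne_zero hK.le hf (stieltjesD_re_pos g hw))
  refine h1.congr fun w hw => ?_
  rw [F1pre_of_re_pos g hq gs qs hw, F0_eq g hK.le hf hq hw]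

/-- Numerator and denominator are continued separately to `Θ` and `1 - iKf₁Φ`. The quotient is a
single analytic germ agreeing with all three branches of `F1pre`. On the axis this holds because the
value there is the limit from the right. -/
lemma analyticAt_F1pre_of_re_eq_zero (hK : 0 < K) (hf : 0 ≤ f₁.im) {y : ℝ}
    (hres : f₁.im = 0 → g y = 0 → K * f₁.re * ∫ ω : ℝ, g ω / (y - ω) ≠ 1)
    (hg : DifferentiableAt ℝ g y)
    (hgs : IsMeromorphicContinuation (fun ω => (g ω : ℂ)) gs) (hqs : IsAnalyticContinuation q qs) :
    AnalyticAt ℂ (F1pre g K f₁ q hq gs qs) (I * y) := by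
  obtain ⟨Φ, hΦa, hΦ⟩ := exists_analytic_continuation_cauchy (integrable_density g) hgs.eq_real
    (hgs.analyticAt_real y)
  obtain ⟨Θ, hΘa, hΘ⟩ := exists_analytic_continuation_cauchy (integrable_mul_density g hq)
    (hs := fun z => qs z * gs z) (fun x => by simp only [hqs.eq_real, hgs.eq_real])
    ((hqs.analyticAt_real y).mul (hgs.analyticAt_real y))
  have hne := boundary_denominator_ne_zero g hK hf hres hg (hgs.analyticAt_real y).continuousAt
    (hgs.eq_real y) hΦa.continuousAt hΦ
  have hΨ : AnalyticAt ℂ (fun z => Θ z / (1 - I * K * f₁ * Φ z)) (I * y) :=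
    hΘa.div (analyticAt_const.sub (analyticAt_const.mul hΦa)) hne
  have hright : ∀ᶠ z in 𝓝 (I * (y : ℂ)), 0 < z.re →
      F0 g K f₁ (hq.toLp q) z = Θ z / (1 - I * K * f₁ * Φ z) := by
    filter_upwards [hΦ, hΘ] with z h1 h2 hz
    rw [F0_eq g hK.le hf hq hz, h1.1 hz, h2.1 hz]
    rfl
  refine hΨ.congr ?_
  filter_upwards [hΦ, hΘ, hright, hright.eventually_nhds, hΨ.eventually_analyticAt]
    with z h1 h2 h3 h4 h5
  rcases lt_trichotomy z.re 0 with hz | hz | hz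
  · rw [F1pre_of_re_neg g hq gs qs hz, h1.2 hz, h2.2 hz]
    change (freePairing g q z + _) / (1 - _ * (stieltjesD g z + _)) = _
    congr 1 <;> ring
  · rw [F1pre_of_re_eq_zero g hq gs qs hz]
    have hnb : (𝓝[{w : ℂ | 0 < w.re}] z).NeBot := by
      rw [← mem_closure_iff_nhdsWithin_neBot, closure_setOfPred_lt_re]
      exact hz.ge
    refine (Tendsto.limUnder_eq ?_).symm
    refine (h5.continuousAt.tendsto.mono_left nhdsWithin_le_nhds).congr' ?_
    filter_upwards [nhdsWithin_le_nhds h4, self_mem_nhdsWithin] with w hw hw0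
    exact (hw hw0).symm
  · rw [F1pre_of_re_pos g hq gs qs hz, h3 hz]

lemma meromorphicAt_F1pre_of_re_neg {z : ℂ} (hz : z.re < 0)
    (hgs : IsMeromorphicContinuation (fun ω => (g ω : ℂ)) gs) (hqs : IsAnalyticContinuation q qs) :
    MeromorphicAt (F1pre g K f₁ q hq gs qs) z := by
  have hopen : IsOpen {w : ℂ | w.re < 0} := isOpen_lt continuous_re continuous_const
  have han : ∀ {h : ℝ → ℂ}, Integrable h →
      MeromorphicAt (fun z => ∫ ω : ℝ, h ω / (z - I * ω)) z := fun hh =>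
    (DifferentiableOn.analyticAt (s := {w : ℂ | w.re < 0})
      (fun w (hw : w.re < 0) => (differentiableAt_cauchy_integral_of_re_ne_zero hh
        hw.ne).differentiableWithinAt) (hopen.mem_nhds hz)).meromorphicAt
  have hQ : MeromorphicAt (freePairing g q) z := han (integrable_mul_density g hq)
  have hD : MeromorphicAt (stieltjesD g) z := han (integrable_density g)
  have him : 0 < (-I * z).im := by simpa using hz
  have hlin : AnalyticAt ℂ (fun z : ℂ => -I * z) z := analyticAt_const.mul analyticAt_id
  have hg1 : MeromorphicAt (fun z => gs (-I * z)) z :=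
    (hgs.meromorphicOn _ him).comp_analyticAt hlin
  have hq1 : MeromorphicAt (fun z => qs (-I * z)) z :=
    ((hqs.analyticOnNhd _ him).comp hlin).meromorphicAt
  have hform : MeromorphicAt (fun z =>
      (freePairing g q z + 2 * Real.pi * qs (-I * z) * gs (-I * z)) /
      (1 - I * K * f₁ * stieltjesD g z - 2 * Real.pi * I * K * f₁ * gs (-I * z))) z := by
    have hc : ∀ c : ℂ, MeromorphicAt (fun _ : ℂ => c) z := fun c => MeromorphicAt.const c z
    exact (hQ.add (((hc _).mul hq1).mul hg1)).div
      (((hc _).sub ((hc _).mul hD)).sub ((hc _).mul hg1))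
  refine hform.congr ?_
  filter_upwards [nhdsWithin_le_nhds (hopen.mem_nhds hz)] with w hw
  exact (F1pre_of_re_neg g hq gs qs hw).symm

/-- The continued function is meromorphic in normal form on the plane, analytic on the closed right
half plane, and agrees with `F₀` on the right. -/
theorem F1_properties (hK : 0 < K) (hf : 0 ≤ f₁.im)
    (hres : f₁.im = 0 → ∀ y : ℝ, g y = 0 → K * f₁.re * ∫ ω : ℝ, g ω / (y - ω) ≠ 1)
    (hg : Differentiable ℝ g)
    (hgs : IsMeromorphicContinuation (fun ω => (g ω : ℂ)) gs) (hqs : IsAnalyticContinuation q qs) :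
    MeromorphicNFOn (F1 g K f₁ q hq gs qs) Set.univ ∧
    (∀ z : ℂ, 0 ≤ z.re → AnalyticAt ℂ (F1 g K f₁ q hq gs qs) z) ∧
    ∀ z : ℂ, 0 < z.re → F1 g K f₁ q hq gs qs z = F0 g K f₁ (hq.toLp q) z := by
  have han : ∀ z : ℂ, 0 ≤ z.re → AnalyticAt ℂ (F1pre g K f₁ q hq gs qs) z := fun z hz => by
    rcases hz.lt_or_eq with hz | hz
    · exact analyticAt_F1pre_of_re_pos g hq hK hf hz
    · have hzy : z = I * (z.im : ℂ) := by
        apply Complex.ext <;> simp [← hz]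
      rw [hzy]
      exact analyticAt_F1pre_of_re_eq_zero g hq hK hf (fun h => hres h z.im) (hg _) hgs hqs
  have hmer : MeromorphicOn (F1pre g K f₁ q hq gs qs) Set.univ := fun z _ => by
    rcases lt_or_ge z.re 0 with hz | hz
    · exact meromorphicAt_F1pre_of_re_neg g hq hz hgs hqs
    · exact (han z hz).meromorphicAt
  have hNF : MeromorphicNFOn (F1 g K f₁ q hq gs qs) Set.univ :=
    meromorphicNFOn_toMeromorphicNFOn _ _
  refine ⟨hNF, fun z hz => ?_, fun z hz => ?_⟩
  · rw [← (hNF (Set.mem_univ z)).meromorphicOrderAt_nonneg_iff_analyticAt, F1,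
      meromorphicOrderAt_toMeromorphicNFOn hmer (Set.mem_univ z)]
    exact (han z hz).meromorphicOrderAt_nonneg
  · rw [F1, toMeromorphicNFOn_eq_toMeromorphicNFAt hmer (Set.mem_univ z),
      toMeromorphicNFAt_eq_self.2 (han z hz.le).meromorphicNFAt, F1pre_of_re_pos g hq gs qs hz]

end Continuation

/-! ### Analyticity and quadratic decay in a strip -/

lemma abs_arg_le_of_abs_im_le {w : ℂ} {d : ℝ} (hd0 : 0 ≤ d) (hd : d ≤ Real.pi / 2) (hw : 0 < w.re)
    (h : |w.im| ≤ Real.sin d * w.re) : |arg w| ≤ d := by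
  rw [arg_of_re_nonneg hw.le]
  have hpos : 0 < ‖w‖ := hw.trans_le (re_le_norm w)
  have h1 : |w.im / ‖w‖| ≤ Real.sin d := by
    rw [abs_div, abs_norm, div_le_iff₀ hpos]
    exact h.trans (mul_le_mul_of_nonneg_left (re_le_norm w)
      (Real.sin_nonneg_of_nonneg_of_le_pi hd0 (by linarith [Real.pi_pos])))
  rw [abs_le] at h1 ⊢
  constructor
  · rw [← Real.arcsin_sin (x := -d) (by linarith) (by linarith [Real.pi_pos]), Real.sin_neg]
    exact Real.monotone_arcsin h1.1
  · calc _ ≤ Real.arcsin (Real.sin d) := Real.monotone_arcsin h1.2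
      _ = d := Real.arcsin_sin (by linarith) hd

lemma exists_cone_subset_verticalSectors {δ : ℝ} (hδ : 0 < δ) :
    ∃ κ : ℝ, 0 < κ ∧ κ ≤ 1 ∧ ∀ z : ℂ, z.im ≠ 0 → |z.re| ≤ κ * |z.im| → z ∈ verticalSectors δ := by
  -- Capping the angle at `1 < π/2` keeps it where `arcsin` inverts `sin`.
  set d := min δ 1
  have hd0 : 0 < d := lt_min hδ one_pos
  have hd1 : d ≤ Real.pi / 2 := (min_le_right _ _).trans (by linarith [Real.pi_gt_three])
  refine ⟨Real.sin d, Real.sin_pos_of_pos_of_lt_pi hd0 (by linarith [Real.pi_gt_three]),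
    Real.sin_le_one d, fun z hz h => ?_⟩
  rcases lt_or_gt_of_ne hz with hz | hz
  · refine Or.inr ((abs_arg_le_of_abs_im_le hd0.le hd1 ?_ ?_).trans (min_le_left _ _))
    · simpa using hz
    · rw [abs_of_neg hz] at h
      simpa using h
  · refine Or.inl ((abs_arg_le_of_abs_im_le hd0.le hd1 ?_ ?_).trans (min_le_left _ _))
    · simpa using hz
    · rw [abs_of_pos hz] at h
      simpa using h

/-- At a pole the norm would tend to infinity, and normal form leaves no removable singularity
unfilled. -/
lemma analyticAt_of_eventually_norm_le {F : ℂ → ℂ} {z : ℂ} (hF : MeromorphicNFAt F z) {M : ℝ}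
    (hb : ∀ᶠ w in 𝓝 z, ‖F w‖ ≤ M) : AnalyticAt ℂ F z := by
  rw [← hF.meromorphicOrderAt_nonneg_iff_analyticAt]
  by_contra! hneg
  have h1 := (tendsto_cobounded_iff_meromorphicOrderAt_neg hF.meromorphicAt).2 hneg
  rw [← tendsto_norm_atTop_iff_cobounded] at h1
  obtain ⟨w, hw1, hw2⟩ := ((h1.eventually_gt_atTop M).and (nhdsWithin_le_nhds hb)).exists
  exact absurd hw2 (not_le.2 hw1)

/-- A meromorphic function that is analytic on the closed right half plane and tends to `0` in the
vertical sectors is analytic on a larger half plane, and its second derivative decays quadratically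
along the vertical lines of a strip. -/
theorem exists_strip_bound {F : ℂ → ℂ} (hNF : MeromorphicNFOn F Set.univ)
    (han : ∀ z : ℂ, 0 ≤ z.re → AnalyticAt ℂ F z) {δ : ℝ} (hδ : 0 < δ)
    (hlim : Tendsto F (Bornology.cobounded ℂ ⊓ 𝓟 (verticalSectors δ)) (𝓝 0)) :
    ∃ γ C : ℝ, 0 < γ ∧ (∀ z : ℂ, -γ ≤ z.re → AnalyticAt ℂ F z) ∧
      ∀ z : ℂ, -γ ≤ z.re → z.re ≤ 1 → ‖deriv (deriv F) z‖ ≤ C / (1 + z.im ^ 2) := by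
  obtain ⟨κ, hκ0, hκ1, hκ⟩ := exists_cone_subset_verticalSectors hδ
  obtain ⟨R, hR⟩ : ∃ R : ℝ, ∀ z ∈ verticalSectors δ, R ≤ ‖z‖ → ‖F z‖ ≤ 1 := by
    have h1 : ∀ᶠ z in Bornology.cobounded ℂ ⊓ 𝓟 (verticalSectors δ), ‖F z‖ ≤ 1 := by
      have h2 := hlim.norm
      rw [norm_zero] at h2
      exact h2.eventually_le_const one_pos
    rw [eventually_inf_principal] at h1
    obtain ⟨R, -, hR⟩ := hasBasis_cobounded_norm.eventually_iff.1 h1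
    exact ⟨R, fun z hz hzR => hR hzR hz⟩
  have hcone : ∀ z : ℂ, z.im ≠ 0 → |z.re| ≤ κ * |z.im| → R ≤ |z.im| → ‖F z‖ ≤ 1 :=
    fun z h1 h2 h3 => hR z (hκ z h1 h2) (h3.trans (abs_im_le_norm z))
  -- For `|Re z| ≤ 1` and `|Im z| ≥ Y`, the disc of radius `κ|Im z|/4` must stay in the cone and
  -- beyond `R`. The bound `4/κ` gives `|Re w| ≤ κ|Im z|/2`, while `|Im w| ≥ 3|Im z|/4`. The bound
  -- `2|R| + 1` makes the latter exceed `R`.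
  set Y : ℝ := max (2 * |R| + 1) (4 / κ) with hY
  have hY1 : 2 * |R| + 1 ≤ Y := le_max_left _ _
  have hY2 : 4 / κ ≤ Y := le_max_right _ _
  have hYR : R ≤ |R| := le_abs_self R
  have hR0 : 0 ≤ |R| := abs_nonneg R
  have hfar : ∀ z : ℂ, |z.re| ≤ 1 → Y ≤ |z.im| →
      ∀ w ∈ Metric.ball z (κ * |z.im| / 4), ‖F w‖ ≤ 1 := fun z h1 h2 w hw => by
    have hd := mem_ball_iff_norm.1 hw
    have hre := (abs_re_le_norm (w - z)).trans_lt hd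
    have him := (abs_im_le_norm (w - z)).trans_lt hd
    rw [sub_re] at hre
    rw [sub_im] at him
    have h4 : 4 ≤ κ * |z.im| := by
      rw [div_le_iff₀ hκ0] at hY2
      nlinarith
    have h5 : κ * |z.im| ≤ |z.im| := mul_le_of_le_one_left (abs_nonneg _) hκ1
    have hre' : |w.re| ≤ |w.re - z.re| + |z.re| := by
      simpa using abs_add_le (w.re - z.re) z.re
    have him' : |z.im| ≤ |w.im| + |w.im - z.im| := by
      have := abs_add_le w.im (-(w.im - z.im))
      rw [abs_neg] at this
      simpa using this
    have h6 : 3 / 4 * |z.im| ≤ |w.im| := by linarith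
    have h7 : κ * (3 / 4 * |z.im|) ≤ κ * |w.im| := mul_le_mul_of_nonneg_left h6 hκ0.le
    refine hcone w (abs_pos.1 (by linarith)) (by linarith) (by linarith)
  have hfar_an : ∀ z : ℂ, |z.re| ≤ 1 → Y ≤ |z.im| →
      ∀ w ∈ Metric.ball z (κ * |z.im| / 4), AnalyticAt ℂ F w := fun z h1 h2 w hw =>
    analyticAt_of_eventually_norm_le (hNF (Set.mem_univ w)) (M := 1)
      (eventually_of_mem (Metric.isOpen_ball.mem_nhds hw) (hfar z h1 h2))
  have hY0 : 0 < Y := by linarith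
  have hrad : ∀ z : ℂ, Y ≤ |z.im| → 0 < κ * |z.im| / 4 := fun z h => by
    have : 0 < |z.im| := by linarith
    positivity
  -- The remaining segment of the axis is compact, so a whole thickening of it lies in the open set
  -- of analyticity.
  obtain ⟨ε, hε, hthick⟩ : ∃ ε > 0, ∀ z : ℂ, -ε ≤ z.re → z.re ≤ 0 → |z.im| ≤ Y →
      AnalyticAt ℂ F z := by
    have hcpt : IsCompact ((fun y : ℝ => I * (y : ℂ)) '' Set.Icc (-Y) Y) :=
      isCompact_Icc.image (by fun_prop)
    obtain ⟨ε, hε, hsub⟩ := hcpt.exists_cthickening_subset_open (isOpen_analyticAt ℂ F) (by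
      rintro _ ⟨y, -, rfl⟩
      exact han _ (by simp))
    refine ⟨ε, hε, fun z h1 h2 h3 => hsub (Metric.mem_cthickening_of_dist_le z (I * (z.im : ℂ)) ε _
      ⟨z.im, abs_le.1 h3, rfl⟩ ?_)⟩
    have : z - I * (z.im : ℂ) = (z.re : ℂ) := by
      apply Complex.ext <;> simp
    rw [dist_eq_norm, this, norm_real, Real.norm_eq_abs, abs_of_nonpos h2]
    linarith
  set γ : ℝ := min ε 1
  have hγ0 : 0 < γ := lt_min hε one_pos
  have hγε : γ ≤ ε := min_le_left _ _
  have hγ1 : γ ≤ 1 := min_le_right _ _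
  have hana : ∀ z : ℂ, -γ ≤ z.re → AnalyticAt ℂ F z := fun z hz => by
    rcases le_total 0 z.re with h0 | h0
    · exact han z h0
    rcases le_total |z.im| Y with h1 | h1
    · exact hthick z (by linarith) h0 h1
    · exact hfar_an z (abs_le.2 ⟨by linarith, by linarith⟩) h1 z (Metric.mem_ball_self (hrad z h1))
  obtain ⟨B, hB⟩ : ∃ B, ∀ z ∈ Set.Icc (-γ) 1 ×ℂ Set.Icc (-Y) Y, ‖deriv (deriv F) z‖ ≤ B :=
    (isCompact_Icc.reProdIm isCompact_Icc).exists_bound_of_continuousOn fun z hz =>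
      (hana z hz.1.1).deriv.deriv.continuousAt.continuousWithinAt
  have hB0 : 0 ≤ B := (norm_nonneg _).trans (hB 0 ⟨⟨by simpa using hγ0.le, by simp⟩,
    ⟨by simpa using hY0.le, by simpa using hY0.le⟩⟩)
  -- The Cauchy estimate with radius `κ|Im z|/8` gives `2! · 64 / (κ Im z)²`. A further factor `2`
  -- comes from `1 + (Im z)² ≤ 2 (Im z)²`.
  refine ⟨γ, B * (1 + Y ^ 2) + 256 / κ ^ 2, hγ0, hana, fun z h1 h2 => ?_⟩
  rw [le_div_iff₀ (by positivity)]
  rcases le_total |z.im| Y with h3 | h3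
  · have h4 := hB z ⟨⟨h1, h2⟩, abs_le.1 h3⟩
    have h5 : z.im ^ 2 ≤ Y ^ 2 := sq_le_sq' (abs_le.1 h3).1 (abs_le.1 h3).2
    have h6 : ‖deriv (deriv F) z‖ * (1 + z.im ^ 2) ≤ B * (1 + Y ^ 2) :=
      mul_le_mul h4 (by linarith) (by positivity) hB0
    have : 0 ≤ 256 / κ ^ 2 := by positivity
    linarith
  · have hre : |z.re| ≤ 1 := abs_le.2 ⟨by linarith, h2⟩
    have hr := hrad z h3
    have hsub : Metric.closedBall z (κ * |z.im| / 8) ⊆ Metric.ball z (κ * |z.im| / 4) :=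
      Metric.closedBall_subset_ball (by linarith)
    have hcauchy := norm_iteratedDeriv_le_of_forall_mem_sphere_norm_le (f := F) (C := 1) 2
      (by linarith : 0 < κ * |z.im| / 8)
      (DifferentiableOn.diffContOnCl fun w hw =>
        (hfar_an z hre h3 w (hsub (closure_minimal Metric.ball_subset_closedBall
          Metric.isClosed_closedBall hw))).differentiableAt.differentiableWithinAt)
      (fun w hw => hfar z hre h3 w (hsub (Metric.sphere_subset_closedBall hw)))
    rw [iteratedDeriv_succ, iteratedDeriv_one, div_pow, mul_pow, sq_abs] at hcauchy
    have hz1 : 1 ≤ z.im ^ 2 := by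
      rw [← sq_abs]
      nlinarith
    have hκ2 : 0 < κ ^ 2 := by positivity
    have h6 : ‖deriv (deriv F) z‖ * (1 + z.im ^ 2) ≤ 256 / κ ^ 2 := by
      refine (mul_le_mul hcauchy (by linarith : 1 + z.im ^ 2 ≤ 2 * z.im ^ 2) (by positivity)
        (by positivity)).trans_eq ?_
      have : z.im ≠ 0 := fun h => by norm_num [h] at hz1
      field_simp
      norm_num [Nat.factorial]
    have : 0 ≤ B * (1 + Y ^ 2) := by positivity
    linarith

/-! ### Laplace inversion and exponential decay -/

lemma integrableOn_pow_mul_exp_neg (n : ℕ) {ε : ℝ} (hε : 0 < ε) :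
    IntegrableOn (fun t : ℝ => t ^ n * Real.exp (-ε * t)) (Set.Ioi 0) := by
  refine integrable_of_isBigO_exp_neg (b := ε / 2) (by positivity) (by fun_prop) ?_
  have h1 := (isLittleO_pow_exp_pos_mul_atTop n (by positivity : 0 < ε / 2)).isBigO
  refine (h1.mul (Asymptotics.isBigO_refl (fun t : ℝ => Real.exp (-ε * t)) atTop)).congr_right
    fun t => ?_
  rw [← Real.exp_add]
  ring_nf

lemma norm_cexp_neg_mul (z : ℂ) (t : ℝ) : ‖cexp (-(z * t))‖ = Real.exp (-z.re * t) := by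
  rw [Complex.norm_exp]
  simp

/-- Differentiation of a Laplace transform. -/
lemma hasDerivAt_laplace {f : ℝ → ℂ} (hf : ContinuousOn f (Set.Ici 0)) {B : ℝ} {n : ℕ}
    (hb : ∀ t, 0 ≤ t → ‖f t‖ ≤ B * t ^ n) {z : ℂ} (hz : 0 < z.re) :
    HasDerivAt (fun z : ℂ => ∫ t in Set.Ioi (0 : ℝ), cexp (-(z * t)) * f t)
      (∫ t in Set.Ioi (0 : ℝ), cexp (-(z * t)) * (-t * f t)) z := by
  have hd : ∀ (t : ℝ) (w : ℂ), HasDerivAt (fun w : ℂ => cexp (-(w * t)) * f t)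
      (cexp (-(w * t)) * (-t * f t)) w := fun t w => by
    have := (((hasDerivAt_id w).mul_const (t : ℂ)).neg.cexp).mul_const (f t)
    refine this.congr_deriv ?_
    simp
    ring
  have key := hasDerivAt_integral_of_dominated (μ := volume.restrict (Set.Ioi (0 : ℝ)))
    (F := fun w (t : ℝ) => cexp (-(w * t)) * f t) (U := {w : ℂ | z.re / 2 < w.re})
    (isOpen_lt continuous_const continuous_re)
    (bound := fun t => B * (t ^ n * Real.exp (-(z.re / 2) * t)))
    (fun w _ => ?_) (Eventually.of_forall fun t w _ =>
      (hd t w).differentiableAt.differentiableWithinAt) ?_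
    ((integrableOn_pow_mul_exp_neg n (by positivity)).const_mul B)
    (w := z) (show z.re / 2 < z.re by linarith)
  · simpa only [(hd _ _).deriv] using key
  · exact ((by fun_prop : Continuous fun t : ℝ => cexp (-(w * t))).continuousOn.mul
      (hf.mono Set.Ioi_subset_Ici_self)).aestronglyMeasurable measurableSet_Ioi
  · filter_upwards [ae_restrict_mem measurableSet_Ioi] with t (ht : 0 < t) w (hw : z.re / 2 < w.re)
    rw [norm_mul, norm_cexp_neg_mul, mul_comm, ← mul_assoc]
    refine mul_le_mul (hb t ht.le) (Real.exp_le_exp.2 (by nlinarith)) (Real.exp_pos _).le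
      ((norm_nonneg _).trans (hb t ht.le))

/-- Shifting the line of integration of a holomorphic function with quadratic decay. -/
lemma integral_vertical_line_eq {G : ℂ → ℂ} {a b C : ℝ} (hab : a ≤ b)
    (hG : ∀ z : ℂ, a ≤ z.re → z.re ≤ b → DifferentiableAt ℂ G z)
    (hC : ∀ z : ℂ, a ≤ z.re → z.re ≤ b → ‖G z‖ ≤ C / (1 + z.im ^ 2)) :
    ∫ y : ℝ, G (a + y * I) = ∫ y : ℝ, G (b + y * I) := by
  have hinteg : ∀ x : ℝ, a ≤ x → x ≤ b → Integrable fun y : ℝ => G (x + y * I) := fun x h1 h2 => by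
    refine Integrable.mono' (g := fun y : ℝ => C * (1 + y ^ 2)⁻¹) (integrable_inv_one_add_sq.const_mul C)
      (Continuous.aestronglyMeasurable (continuous_iff_continuousAt.2 fun y => ?_))
      (Eventually.of_forall fun y => ?_)
    · refine ContinuousAt.comp (f := fun y : ℝ => (x : ℂ) + y * I) (g := G)
        (hG _ (by simpa using h1) (by simpa using h2)).continuousAt (by fun_prop)
    · have := hC (x + y * I) (by simpa using h1) (by simpa using h2)
      simpa [div_eq_mul_inv] using this
  have hvert : ∀ x : ℝ, a ≤ x → x ≤ b → Tendsto (fun T : ℝ => ∫ y in (-T)..T, G (x + y * I)) atTop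
      (𝓝 (∫ y : ℝ, G (x + y * I))) := fun x h1 h2 =>
    intervalIntegral_tendsto_integral (hinteg x h1 h2) tendsto_neg_atTop_atBot tendsto_id
  have hhor : ∀ T : ℝ, ‖∫ x in a..b, G (x + T * I)‖ ≤ C / (1 + T ^ 2) * |b - a| := fun T => by
    refine intervalIntegral.norm_integral_le_of_norm_le_const fun x hx => ?_
    rw [Set.uIoc_of_le hab] at hx
    have := hC (x + T * I) (by simpa using hx.1.le) (by simpa using hx.2)
    simpa using this
  have hdecay : Tendsto (fun T : ℝ => C / (1 + T ^ 2) * |b - a|) atTop (𝓝 0) := by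
    have h1 : Tendsto (fun T : ℝ => 1 + T ^ 2) atTop atTop :=
      tendsto_atTop_add_const_left _ _ (tendsto_pow_atTop two_ne_zero)
    simpa using (h1.const_div_atTop C).mul_const |b - a|
  have hrect : ∀ T : ℝ, I • ((∫ y in (-T)..T, G (b + y * I)) - ∫ y in (-T)..T, G (a + y * I)) =
      (∫ x in a..b, G (x + T * I)) - ∫ x in a..b, G (x + (-T : ℝ) * I) := fun T => by
    have := integral_boundary_rect_eq_zero_of_differentiableOn G ⟨a, -T⟩ ⟨b, T⟩ (fun z hz => by
      rw [Set.uIcc_of_le hab] at hz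
      exact (hG z hz.1.1 hz.1.2).differentiableWithinAt)
    simp only at this
    rw [smul_sub]
    linear_combination this
  have h1 : Tendsto (fun T : ℝ => I • ((∫ y in (-T)..T, G (b + y * I)) -
      ∫ y in (-T)..T, G (a + y * I))) atTop (𝓝 0) := by
    simp only [hrect]
    have e1 : Tendsto (fun T : ℝ => ∫ x in a..b, G (x + T * I)) atTop (𝓝 0) :=
      squeeze_zero_norm hhor hdecay
    have e2 : Tendsto (fun T : ℝ => ∫ x in a..b, G (x + (-T : ℝ) * I)) atTop (𝓝 0) :=
      squeeze_zero_norm (fun T => by simpa using hhor (-T)) hdecay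
    simpa using e1.sub e2
  have h2 := ((hvert b hab le_rfl).sub (hvert a le_rfl hab)).const_smul I
  have h3 := tendsto_nhds_unique h1 h2
  have h4 := (smul_eq_zero.1 h3.symm).resolve_left I_ne_zero
  exact (sub_eq_zero.1 h4).symm

/-- A bounded continuous function whose Laplace transform extends analytically to `Re z ≥ -γ`, with
quadratically decaying second derivative, decays like `e^{-γt}`. -/
theorem decaysExponentially_of_laplace {Z : ℝ → ℂ} {F : ℂ → ℂ} {B C γ : ℝ} (hγ : 0 < γ)
    (hZc : ContinuousOn Z (Set.Ici 0)) (hZb : ∀ t, 0 ≤ t → ‖Z t‖ ≤ B)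
    (hL : ∀ z : ℂ, 0 < z.re → ∫ t in Set.Ioi (0 : ℝ), cexp (-(z * t)) * Z t = F z)
    (han : ∀ z : ℂ, -γ ≤ z.re → AnalyticAt ℂ F z)
    (hC : ∀ z : ℂ, -γ ≤ z.re → z.re ≤ 1 → ‖deriv (deriv F) z‖ ≤ C / (1 + z.im ^ 2)) :
    DecaysExponentially Z := by
  have hopen : IsOpen {w : ℂ | 0 < w.re} := isOpen_lt continuous_const continuous_re
  have hd1 : ∀ z : ℂ, 0 < z.re →
      deriv F z = ∫ t in Set.Ioi (0 : ℝ), cexp (-(z * t)) * (-t * Z t) := fun z hz => by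
    have h1 := hasDerivAt_laplace (n := 0) hZc (fun t ht => by simpa using hZb t ht) hz
    rw [← h1.deriv]
    refine EventuallyEq.deriv_eq ?_
    filter_upwards [hopen.mem_nhds hz] with w hw using (hL w hw).symm
  have hd2 : ∀ z : ℂ, 0 < z.re →
      deriv (deriv F) z = ∫ t in Set.Ioi (0 : ℝ), cexp (-(z * t)) * (t ^ 2 * Z t) := fun z hz => by
    have h1 := hasDerivAt_laplace (f := fun t => -t * Z t) (n := 1) (B := B)
      ((by fun_prop : Continuous fun t : ℝ => -(t : ℂ)).continuousOn.mul hZc) (fun t ht => by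
        rw [norm_mul, norm_neg, norm_real, Real.norm_eq_abs, abs_of_nonneg ht, pow_one, mul_comm]
        exact mul_le_mul_of_nonneg_right (hZb t ht) ht) hz
    have h2 : ∀ t : ℝ, (t : ℂ) ^ 2 * Z t = -t * (-t * Z t) := fun t => by ring
    simp only [h2]
    rw [← h1.deriv]
    refine EventuallyEq.deriv_eq ?_
    filter_upwards [hopen.mem_nhds hz] with w hw using hd1 w hw
  -- This is `e^{-t} t² Z t` for `t ≥ 0`, extended by zero. The factor `t²` makes the extension
  -- continuous at `0`, and the Fourier transform of `k` is `F''` on the line `Re z = 1`.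
  set k : ℝ → ℂ := fun t => cexp (-t) * ((max t 0 : ℝ) ^ 2 * Z (max t 0)) with hk
  have hkc : Continuous k := by
    have h1 : Continuous fun t : ℝ => Z (max t 0) :=
      hZc.comp_continuous (by fun_prop) fun t => le_max_right t 0
    exact (by fun_prop : Continuous fun t : ℝ => cexp (-t)).mul
      ((by fun_prop : Continuous fun t : ℝ => ((max t 0 : ℝ) : ℂ) ^ 2).mul h1)
  have hkneg : ∀ t : ℝ, t ∉ Set.Ioi (0 : ℝ) → k t = 0 := fun t ht => by
    simp [hk, max_eq_right (le_of_not_gt ht : t ≤ 0)]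
  have hkpos : ∀ t : ℝ, 0 ≤ t → k t = cexp (-t) * (t ^ 2 * Z t) := fun t ht => by
    simp only [hk, max_eq_left ht]
  have hki : Integrable k := by
    rw [← integrableOn_iff_integrable_of_support_subset (s := Set.Ioi 0)
      (fun t ht => by_contra fun h => ht (hkneg t h))]
    refine Integrable.mono' ((integrableOn_pow_mul_exp_neg 2 one_pos).const_mul B)
      hkc.aestronglyMeasurable ?_
    filter_upwards [ae_restrict_mem measurableSet_Ioi] with t (ht : 0 < t)
    rw [hkpos t ht.le, norm_mul, norm_mul, norm_pow, norm_real, Real.norm_eq_abs, sq_abs,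
      Complex.norm_exp, neg_re, ofReal_re, neg_one_mul]
    have := hZb t ht.le
    calc Real.exp (-t) * (t ^ 2 * ‖Z t‖) = ‖Z t‖ * (t ^ 2 * Real.exp (-t)) := by ring
      _ ≤ _ := by gcongr
  have hFk : ∀ ξ : ℝ, FourierTransform.fourier k ξ =
      deriv (deriv F) ((1 : ℝ) + (2 * Real.pi * ξ : ℝ) * I) := fun ξ => by
    rw [Real.fourier_real_eq_integral_exp_smul, hd2 _ (by simp),
      ← setIntegral_eq_integral_of_forall_compl_eq_zero (s := Set.Ioi 0)
        (fun t ht => by rw [hkneg t ht, smul_zero])]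
    refine setIntegral_congr_fun measurableSet_Ioi fun t (ht : 0 < t) => ?_
    simp only [hkpos t ht.le, smul_eq_mul]
    rw [← mul_assoc, ← Complex.exp_add]
    congr 2
    push_cast
    ring
  have hFki : Integrable (FourierTransform.fourier k) := by
    have h1 : Integrable fun ξ : ℝ => C * (1 + (2 * Real.pi * ξ) ^ 2)⁻¹ :=
      (integrable_inv_one_add_sq.comp_mul_left' (by positivity : 2 * Real.pi ≠ 0)).const_mul C
    refine h1.mono' ?_ (Eventually.of_forall fun ξ => ?_)
    · exact (VectorFourier.fourierIntegral_continuous Real.continuous_fourierChar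
        (by fun_prop) hki).aestronglyMeasurable
    · rw [hFk]
      have := hC ((1 : ℝ) + (2 * Real.pi * ξ : ℝ) * I) (by simp; linarith) (by simp)
      simpa [div_eq_mul_inv] using this
  have hinv : ∀ t : ℝ, 0 < t → (t : ℂ) ^ 2 * Z t =
      ∫ ξ : ℝ, cexp (((1 : ℝ) + (2 * Real.pi * ξ : ℝ) * I) * t) *
        deriv (deriv F) ((1 : ℝ) + (2 * Real.pi * ξ : ℝ) * I) := fun t ht => by
    have h1 := congrFun (hkc.fourierInv_fourier_eq hki hFki) t
    rw [Real.fourierInv_eq', hkpos t ht.le] at h1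
    have h2 : (t : ℂ) ^ 2 * Z t = cexp t * (cexp (-t) * (t ^ 2 * Z t)) := by
      rw [← mul_assoc, ← Complex.exp_add, add_neg_cancel, Complex.exp_zero, one_mul]
    rw [h2, ← h1, ← integral_const_mul]
    refine integral_congr_ae (Eventually.of_forall fun ξ => ?_)
    simp only [hFk, smul_eq_mul]
    rw [← mul_assoc, ← Complex.exp_add]
    congr 2
    simp
    ring
  have hB0 : 0 ≤ B := (norm_nonneg _).trans (hZb 0 le_rfl)
  have hC0 : 0 ≤ C := by
    have := (norm_nonneg _).trans (hC 0 (by simpa using hγ.le) (by simp))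
    simpa using this
  have hbound : ∀ t : ℝ, 0 < t → ‖(t : ℂ) ^ 2 * Z t‖ ≤ C * Real.exp (-γ * t) := fun t ht => by
    set G : ℂ → ℂ := fun z => cexp (z * t) * deriv (deriv F) z with hG
    have hGn : ∀ z : ℂ, -γ ≤ z.re → z.re ≤ 1 →
        ‖G z‖ ≤ Real.exp (z.re * t) * (C / (1 + z.im ^ 2)) := fun z h1 h2 => by
      rw [hG, norm_mul, Complex.norm_exp, re_mul_ofReal]
      exact mul_le_mul_of_nonneg_left (hC z h1 h2) (Real.exp_pos _).le
    -- For fixed `t > 0` the factor `e^{t Re z}` is at most `e^t` on the strip. This constant serves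
    -- only to justify the shift; the final bound uses the line `Re z = -γ`.
    have hshift := integral_vertical_line_eq (G := G) (a := -γ) (b := 1)
      (C := Real.exp t * C) (by linarith)
      (fun z h1 _ => DifferentiableAt.mul (by fun_prop) (han z h1).deriv.deriv.differentiableAt)
      (fun z h1 h2 => (hGn z h1 h2).trans (by
        rw [mul_div_assoc]
        gcongr
        nlinarith))
    have hscale := Measure.integral_comp_mul_left (fun y : ℝ => G ((1 : ℝ) + y * I)) (2 * Real.pi)
    have hnorm : ‖∫ y : ℝ, G ((-γ : ℝ) + y * I)‖ ≤ Real.exp (-γ * t) * C * Real.pi := by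
      rw [← integral_univ_inv_one_add_sq, ← integral_const_mul]
      refine norm_integral_le_of_norm_le (integrable_inv_one_add_sq.const_mul _)
        (Eventually.of_forall fun y => ?_)
      have := hGn ((-γ : ℝ) + y * I) (by simp) (by simp; linarith)
      simpa [div_eq_mul_inv, mul_assoc] using this
    rw [hinv t ht]
    change ‖∫ ξ : ℝ, G ((1 : ℝ) + ((2 * Real.pi * ξ : ℝ) : ℂ) * I)‖ ≤ _
    rw [hscale, ← hshift, norm_smul, Real.norm_eq_abs, abs_abs, abs_of_pos (by positivity)]
    refine (mul_le_mul_of_nonneg_left hnorm (by positivity)).trans ?_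
    have hπ := Real.pi_pos
    have : (2 * Real.pi)⁻¹ * (Real.exp (-γ * t) * C * Real.pi) = C * Real.exp (-γ * t) / 2 := by
      field_simp
    rw [this]
    exact half_le_self (by positivity)
  -- The first term covers `t ≤ 1`, where `e^{γ(1-t)} ≥ 1`. The second covers `t ≥ 1`, where the
  -- factor `t²` may be dropped.
  refine ⟨B * Real.exp γ + C, γ, hγ, fun t ht => ?_⟩
  have he : 0 < Real.exp (-γ * t) := Real.exp_pos _
  rw [add_mul]
  rcases le_total t 1 with h1 | h1
  · have h2 : 1 ≤ Real.exp γ * Real.exp (-γ * t) := by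
      rw [← Real.exp_add]
      exact Real.one_le_exp (by nlinarith)
    have h3 : B ≤ B * Real.exp γ * Real.exp (-γ * t) := by
      rw [mul_assoc]
      exact le_mul_of_one_le_right hB0 h2
    exact ((hZb t ht).trans h3).trans (le_add_of_nonneg_right (by positivity))
  · have h2 := hbound t (by linarith)
    rw [norm_mul, norm_pow, norm_real, Real.norm_eq_abs, sq_abs] at h2
    have h3 : ‖Z t‖ ≤ t ^ 2 * ‖Z t‖ := le_mul_of_one_le_left (norm_nonneg _) (by nlinarith)
    exact (h3.trans h2).trans (le_add_of_nonneg_left (by positivity))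

end KuramotoDaido

end

open KuramotoDaido in
theorem theorem3p12 (g : ProbDensity) (gs : ℂ → ℂ) (q : ℝ → ℂ) (qs : ℂ → ℂ) (f₁ : ℂ) (K : ℝ)
    (hK : 0 < K) (hf : 0 ≤ f₁.im)
    (hres : f₁.im = 0 → ∀ y : ℝ, g y = 0 → K * f₁.re * ∫ ω : ℝ, g ω / (y - ω) ≠ 1)
    (hg : AnalyticOnNhd ℝ g Set.univ)
    (hgs : IsMeromorphicContinuation (fun ω => (g ω : ℂ)) gs)
    (hq : MemLp q 2 g.measure)
    (hqa : AnalyticOnNhd ℝ q Set.univ)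
    (hqs : IsAnalyticContinuation q qs)
    (hF : GrowthCondition (F1 g K f₁ q hq gs qs)) :
    (∃ S : C0Semigroup g.L2, S.IsGeneratedBy (T1 g K f₁)) ∧
    ∀ S : C0Semigroup g.L2, S.IsGeneratedBy (T1 g K f₁) →
      DecaysExponentially (fun t => inner ℂ (P0 g) (S.toFun t (hq.toLp q))) := by
  -- The contraction bound and the Laplace identity hold for every semigroup generated by `T₁`, so
  -- no uniqueness statement is needed.
  refine ⟨exists_semigroup g K f₁, fun S hS => ?_⟩
  obtain ⟨hNF, han, hF0⟩ := F1_properties g hq hK hf hres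
    (fun y => (hg y (Set.mem_univ y)).differentiableAt) hgs hqs
  obtain ⟨δ, hδ, hlim, -⟩ := hF
  obtain ⟨γ, C, hγ, hana, hC⟩ := exists_strip_bound hNF han hδ hlim
  refine decaysExponentially_of_laplace (B := ‖P0 g‖ * ‖hq.toLp q‖) hγ ?_ (fun t ht => ?_)
    (fun z hz => ?_) hana hC
  · exact continuousOn_const.inner (S.continuousOn (hq.toLp q))
  · exact (norm_inner_le_norm _ _).trans (mul_le_mul_of_nonneg_left
      (norm_semigroup_apply_le g hK.le hf hS ht _) (norm_nonneg _))
  · rw [hF0 z hz, laplace_eq_F0 g hK.le hf hS hq hz]
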